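/- Let $\mathcal X$ be a measurable space and let $\mathcal B\subset\{(b^{(1)},b^{(2)})\in\mathbb R^2: 0\le b^{(2)}\le b^{(1)}\}$ be a set of bid pairs (highest and second highest bid) with $M:=\sup_{\mathbf b\in\mathcal B}b^{(1)}<\infty$. For $r\in\mathbb R$, $\mathbf b\in\mathcal B$ and $\gamma>0$ define the true loss and the surrogate loss $$L(r,\mathbf b)=-b^{(2)}1_{r<b^{(2)}}-r\,1_{b^{(2)}\le r\le b^{(1)}},$$ $$L_\gamma(r,\mathbf b)=-b^{(2)}1_{r\le b^{(2)}}-r\,1_{b^{(2)}<r\le b^{(1)}}+\tfrac1\gamma\bigl(r-(1+\gamma)b^{(1)}\bigr)1_{b^{(1)}<r\le(1+\gamma)b^{(1)}}.$$ Let $D$ be a probability distribution on $\mathcal X\times\mathcal B$, and let $H$ be a convex set of measurable functions $h:\mathcal X\to\mathbb R$ that contains $0$ and has finite pseudo-dimension $d$ (the VC dimension of the sets $\{(x,t)\in\mathcal X\times\mathbb R: h(x)>t\}$, $h\in H$). Put $\mathcal L(h)=\mathbb E_{(x,\mathbf b)\sim D}[L(h(x),\mathbf b)]$ and $\mathcal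 L^*=\inf_{h\in H}\mathcal L(h)$. For a sample $S=((x_1,\mathbf b_1),\dots,(x_m,\mathbf b_m))$ drawn i.i.d. from $D$, with $m\ge1$ and $m\ge d$, let $$\mathfrak R_m(H)=\mathbb E_{S}\,\mathbb E_{\sigma}\Bigl[\sup_{h\in H}\tfrac1m\sum_{i=1}^m\sigma_ih(x_i)\Bigr]\in[0,\infty],$$ where the $\sigma_i$ are independent and uniform on $\{-1,+1\}$. Fix $\gamma>0$ and $\delta>0$. Then, with probability at least $1-\delta$ over the choice of $S$, every minimiser $\widehat h_\gamma$ over $H$ of the empirical surrogate loss $h\mapsto\frac1m\sum_{i=1}^mL_\gamma(h(x_i),\mathbf b_i)$ satisfies $$\mathcal L(\widehat h_\gamma)\le\mathcal L^*+\frac{2\gamma+2}{\gamma}\,\mathfrak R_m(H)+\gamma M+2M\sqrt{\frac{2d\log(em/d)}{m}}+2M\sqrt{\frac{\log(2/\delta)}{2m}}.$$ For $d=0$ the term with $d$ is read as $0$, and for $\delta\ge 1$ the assertion is empty. (Precisely: the set of samples for which some minimiser violates the inequality has outer measure at most $\delta$.) -/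

import Mathlib

open MeasureTheory

namespace ReserveLearning

/-- Revenue of a second-price auction with reserve price `r`; `b.1` is the highest bid and
`b.2` the second highest bid. -/
noncomputable def revenue (r : ℝ) (b : ℝ × ℝ) : ℝ :=
  (if r < b.2 then b.2 else 0) + (if b.2 ≤ r ∧ r ≤ b.1 then r else 0)

/-- The true loss `L`. -/
noncomputable def loss (r : ℝ) (b : ℝ × ℝ) : ℝ := -revenue r b

/-- The surrogate loss `L_γ`. -/
noncomputable def surrogateLoss (γ : ℝ) (r : ℝ) (b : ℝ × ℝ) : ℝ :=
  -(if r ≤ b.2 then b.2 else 0) - (if b.2 < r ∧ r ≤ b.1 then r else 0)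
    + (if b.1 < r ∧ r ≤ (1 + γ) * b.1 then (1 / γ) * (r - (1 + γ) * b.1) else 0)

/-- Expected loss of the hypothesis `h` under the distribution `D` on `X × B`, for a loss
function `ℓ`. -/
noncomputable def expectedLoss {X : Type*} [MeasurableSpace X] {B : Set (ℝ × ℝ)}
    (ℓ : ℝ → ℝ × ℝ → ℝ) (D : Measure (X × B)) (h : X → ℝ) : ℝ :=
  ∫ z, ℓ (h z.1) z.2 ∂D

/-- Empirical loss of the hypothesis `h` on the sample `S`, for a loss function `ℓ`. -/
noncomputable def empiricalLoss {X : Type*} {B : Set (ℝ × ℝ)} (ℓ : ℝ → ℝ × ℝ → ℝ)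
    {m : ℕ} (S : Fin m → X × B) (h : X → ℝ) : ℝ :=
  (1 / (m : ℝ)) * ∑ i, ℓ (h (S i).1) (S i).2

/-- `h` is an empirical minimiser over `H`, for the loss function `ℓ` and the sample `S`. -/
def IsEmpiricalMinimiser {X : Type*} {B : Set (ℝ × ℝ)} (ℓ : ℝ → ℝ × ℝ → ℝ)
    {m : ℕ} (S : Fin m → X × B) (H : Set (X → ℝ)) (h : X → ℝ) : Prop :=
  h ∈ H ∧ ∀ g ∈ H, empiricalLoss ℓ S h ≤ empiricalLoss ℓ S g

/-- The best-in-class true loss. -/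
noncomputable def bestLoss {X : Type*} [MeasurableSpace X] {B : Set (ℝ × ℝ)}
    (D : Measure (X × B)) (H : Set (X → ℝ)) : ℝ :=
  sInf (expectedLoss loss D '' H)

/-- The finite set `A` is shattered by the family `F`: every subset of `A` is the trace on `A`
of a member of `F`. -/
def Shatters {Z : Type*} (F : Set (Set Z)) (A : Finset Z) : Prop :=
  ∀ T : Set Z, T ⊆ A → ∃ C ∈ F, C ∩ A = T

/-- Vapnik–Chervonenkis dimension of a family of sets. -/
noncomputable def vcDim {Z : Type*} (F : Set (Set Z)) : ℕ∞ :=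
  ⨆ (A : Finset Z) (_ : Shatters F A), (A.card : ℕ∞)

/-- Pseudo-dimension of a family of real functions: the VC dimension of the family of sets
`{(x, t) | h x > t}`, for `h ∈ H`. -/
noncomputable def pseudoDim {X : Type*} (H : Set (X → ℝ)) : ℕ∞ :=
  vcDim ((fun h : X → ℝ => {p : X × ℝ | h p.1 > p.2}) '' H)

/-- Empirical Rademacher complexity of `G` on the points `z`: the average over all sign vectors
of the supremum over `G` (which may be `⊤`) of the normalised signed sum. -/
noncomputable def empiricalRademacher {Z : Type*} (G : Set (Z → ℝ)) {m : ℕ} (z : Fin m → Z) :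
    EReal :=
  ((((2 : ℝ) ^ m)⁻¹ : ℝ) : EReal) * ∑ σ : Fin m → ℤˣ,
    ⨆ g ∈ G, (((1 / (m : ℝ)) * ∑ i, ((σ i : ℤ) : ℝ) * g (z i) : ℝ) : EReal)

/-- The empirical Rademacher complexity of a nonempty family is nonnegative. -/
theorem empiricalRademacher_nonneg {Z : Type*} {G : Set (Z → ℝ)} (hG : G.Nonempty) {m : ℕ}
    (z : Fin m → Z) : 0 ≤ empiricalRademacher G z := by
  obtain ⟨g, hg⟩ := hG
  refine mul_nonneg (by exact_mod_cast (by positivity : (0 : ℝ) ≤ ((2 : ℝ) ^ m)⁻¹)) ?_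
  have key : (0 : EReal) = ∑ σ : Fin m → ℤˣ,
      (((1 / (m : ℝ)) * ∑ i, ((σ i : ℤ) : ℝ) * g (z i) : ℝ) : EReal) := by
    have h0 : ∑ σ : Fin m → ℤˣ, ((1 / (m : ℝ)) * ∑ i, ((σ i : ℤ) : ℝ) * g (z i)) = 0 := by
      have h1 := Equiv.sum_comp (Equiv.neg (Fin m → ℤˣ))
        (fun σ => (1 / (m : ℝ)) * ∑ i, ((σ i : ℤ) : ℝ) * g (z i))
      simp only [Equiv.neg_apply, Pi.neg_apply, Units.val_neg, Int.cast_neg, neg_mul,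
        Finset.sum_neg_distrib, mul_neg] at h1
      linarith
    have h2 : ∀ s : Finset (Fin m → ℤˣ), ∀ f : (Fin m → ℤˣ) → ℝ,
        ((∑ σ ∈ s, f σ : ℝ) : EReal) = ∑ σ ∈ s, (f σ : EReal) := by
      intro s f
      induction s using Finset.cons_induction with
      | empty => simp
      | cons a s ha ih => rw [Finset.sum_cons, Finset.sum_cons, EReal.coe_add, ih]
    rw [← h2, h0, EReal.coe_zero]
  rw [key]
  exact Finset.sum_le_sum fun σ _ => le_iSup₂_of_le g hg le_rfl

/-- Rademacher complexity of `G` for i.i.d. samples of size `m` with law `μ`: the expectation of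
the empirical Rademacher complexity, an extended nonnegative number. For nonempty `G` the
conversion to `ℝ≥0∞` loses nothing, by `empiricalRademacher_nonneg`. -/
noncomputable def rademacher {Z : Type*} [MeasurableSpace Z] (G : Set (Z → ℝ)) (μ : Measure Z)
    (m : ℕ) : ENNReal :=
  ∫⁻ z, (empiricalRademacher G z).toENNReal ∂(Measure.pi fun _ : Fin m => μ)

end ReserveLearning

open ReserveLearning

namespace ReserveLearning
open Filter Topology ProbabilityTheory

/-! Let ĥ minimise the empirical surrogate loss and let g ∈ H, chosen independently of the sample,
nearly attain 𝓛*. With hats for empirical means, and up to error terms, 𝓛(ĥ) ≲ L̂(ĥ) ≲ L̂_γ(ĥ) ≤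
L̂_γ(g) ≲ 𝓛_γ(g) ≤ 𝓛(g).

The second step costs γM (`empiricalLoss_le_of_isEmpiricalMinimiser`). Since H is convex and
contains 0, s • ĥ is a competitor for s < 1. On the ramp b⁽¹⁾ < r ≤ (1+γ)b⁽¹⁾, shrinking r lowers
L_γ at rate r/γ, which is at least 1/γ times the gap L - L_γ ≤ b⁽¹⁾. Off the ramp the gap is 0 and
L_γ rises at rate at most M. At a minimiser the two effects balance, so the mean gap is at most γM.

The first step is a uniform deviation bound for the true loss: McDiarmid
(`measure_lt_of_bounded_differences`) and symmetrization (`integral_deviation_le`). The loss jumps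
at b⁽¹⁾, so it is split into a 1-Lipschitz clipped part, handled by contraction
(`sum_ciSup_le_of_contraction`), and the jump b⁽¹⁾·1_{r > b⁽¹⁾}, handled by Sauer–Shelah and Massart
(`average_ciSup_jump_le`). The fourth step is Hoeffding's inequality for one function. No uniform
bound for L_γ is needed, so the complexity enters with coefficient 2 ≤ (2γ+2)/γ.

Measurability: a convex class containing 0 with finite pseudo-dimension spans a finite-dimensional
space, hence has a countable sequentially dense subclass (`exists_countable_seq_dense`). Although
the loss is discontinuous, large deviations pass to this subclass
(`exists_deviation_gt_of_seq_dense`). -/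

/-! ### Pseudo-dimension, linear dimension and countable dense subclasses. -/

theorem card_le_of_shatters_of_vcDim_le {Z : Type*} {F : Set (Set Z)} {d : ℕ}
    (hF : vcDim F ≤ d) {A : Finset Z} (hA : Shatters F A) : A.card ≤ d := by
  have h : (A.card : ℕ∞) ≤ vcDim F :=
    le_iSup₂_of_le (f := fun (A : Finset Z) (_ : Shatters F A) => (A.card : ℕ∞)) A hA le_rfl
  exact_mod_cast h.trans hF

/-- Pseudo-shattering of indexed points bounds the number of indices. -/
theorem card_le_of_pseudoDim_le {X κ : Type*} {H : Set (X → ℝ)} {d : ℕ}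
    (hH : pseudoDim H ≤ d) (s : Finset κ) (x : κ → X) (t : κ → ℝ)
    (hs : ∀ u ⊆ s, ∃ h ∈ H, ∀ i ∈ s, t i < h (x i) ↔ i ∈ u) : s.card ≤ d := by
  classical
  have hinj : Set.InjOn (fun i => (x i, t i)) (s : Set κ) := by
    intro i hi j hj hij
    obtain ⟨h, -, hh⟩ := hs {i} (by simpa using hi)
    have h1 := (hh i hi).2 (by simp)
    simp only [Prod.mk.injEq] at hij
    rw [hij.1, hij.2] at h1
    have := (hh j hj).1 h1
    exact (Finset.mem_singleton.1 this).symm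
  rw [← Finset.card_image_of_injOn hinj]
  refine card_le_of_shatters_of_vcDim_le hH fun T hT => ?_
  obtain ⟨h, hhH, hh⟩ := hs (s.filter fun i => (x i, t i) ∈ T) (Finset.filter_subset _ _)
  refine ⟨_, ⟨h, hhH, rfl⟩, ?_⟩
  ext p
  constructor
  · rintro ⟨hp, hpA⟩
    obtain ⟨i, hi, rfl⟩ := Finset.mem_image.1 (Finset.mem_coe.1 hpA)
    have := (hh i hi).1 hp
    exact (Finset.mem_filter.1 this).2
  · intro hp
    refine ⟨?_, hT hp⟩
    obtain ⟨i, hi, rfl⟩ := Finset.mem_image.1 (Finset.mem_coe.1 (hT hp))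
    exact (hh i hi).2 (Finset.mem_filter.2 ⟨hi, hp⟩)

/-- Linearly independent functions can be separated by as many evaluation points. -/
theorem exists_eval_surjective {X κ : Type*} [Fintype κ] {v : κ → X → ℝ}
    (hv : LinearIndependent ℝ v) :
    ∃ x : κ → X, ∀ y : κ → ℝ, ∃ c : κ → ℝ, ∀ j, ∑ i, c i * v i (x j) = y j := by
  classical
  let e : X → κ → ℝ := fun x i => v i x
  have hexp : ∀ (f : (κ → ℝ) →ₗ[ℝ] ℝ) (w : κ → ℝ), f w = ∑ i, w i * f (Pi.single i 1) :=
    fun f w => by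
    conv_lhs => rw [pi_eq_sum_univ' w, map_sum]
    exact Finset.sum_congr rfl fun i _ => by rw [map_smul, smul_eq_mul]
  -- A functional vanishing on all evaluation vectors is a linear relation between the `v i`, so
  -- these vectors span and a basis can be chosen among them.
  have hspan : Submodule.span ℝ (Set.range e) = ⊤ := by
    by_contra hne
    obtain ⟨f, hf0, hf⟩ := Submodule.exists_le_ker_of_lt_top _ (lt_top_iff_ne_top.2 hne)
    apply hf0
    have hz : ∑ i, f (Pi.single i 1) • v i = 0 := by
      ext x
      have h1 : f (e x) = 0 := hf (Submodule.subset_span ⟨x, rfl⟩)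
      rw [hexp] at h1
      simpa [e, mul_comm] using h1
    have h2 := Fintype.linearIndependent_iff.1 hv _ hz
    ext i
    simpa using h2 i
  obtain ⟨κ', a, ha, hsp, hli⟩ := exists_linearIndependent' ℝ e
  rw [hspan] at hsp
  let b := Module.Basis.mk hli hsp.ge
  let b' := b.reindex (b.indexEquiv (Pi.basisFun ℝ κ))
  let x : κ → X := fun j => a ((b.indexEquiv (Pi.basisFun ℝ κ)).symm j)
  have hb' : ∀ j, b' j = e (x j) := fun j => by
    simp [b', b, x]
  refine ⟨x, fun y => ?_⟩
  let f : (κ → ℝ) →ₗ[ℝ] ℝ := b'.constr ℝ y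
  refine ⟨fun i => f (Pi.single i 1), fun j => ?_⟩
  have h1 : f (e (x j)) = y j := by rw [← hb']; exact b'.constr_basis ℝ y j
  rw [← h1, hexp]
  exact Finset.sum_congr rfl fun i _ => mul_comm _ _

theorem sum_mul_mem_of_convex {X κ : Type*} [Fintype κ] {H : Set (X → ℝ)} (hH : Convex ℝ H)
    (h0 : (0 : X → ℝ) ∈ H) {v : κ → X → ℝ} (hv : ∀ i, v i ∈ H) {a : κ → ℝ} (ha : ∀ i, 0 ≤ a i)
    (ha1 : ∑ i, a i ≤ 1) : ∑ i, a i • v i ∈ H := by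
  -- The missing weight 1 - ∑ a is put on the point 0, indexed by `none`.
  have := hH.sum_mem (t := (Finset.univ : Finset (Option κ)))
    (w := fun o => o.elim (1 - ∑ i, a i) a) (z := fun o => o.elim 0 v) ?_ ?_ ?_
  · simpa [Fintype.sum_option] using this
  · rintro (_ | i) _
    · simpa using ha1
    · exact ha i
  · simp [Fintype.sum_option]
  · rintro (_ | i) _
    · exact h0
    · exact hv i

/-- A convex family containing `0` has at most `d` linearly independent members if its
pseudo-dimension is at most `d`. -/
theorem card_le_of_linearIndependent {X κ : Type*} [Fintype κ] {H : Set (X → ℝ)} {d : ℕ}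
    (hd : pseudoDim H ≤ d) (hH : Convex ℝ H) (h0 : (0 : X → ℝ) ∈ H) {v : κ → X → ℝ}
    (hvH : ∀ i, v i ∈ H) (hv : LinearIndependent ℝ v) : Fintype.card κ ≤ d := by
  classical
  rcases isEmpty_or_nonempty κ with hκ | hκ
  · simp
  obtain ⟨x, hx⟩ := exists_eval_surjective hv
  set n : ℝ := (Fintype.card κ : ℝ) with hn
  have hnpos : 0 < n := by simp [hn, Fintype.card_pos]
  -- The thresholds are the values of the combination with all weights 1/(2n), an interior point of
  -- the simplex {a ≥ 0, ∑ a ≤ 1}. Small perturbations stay in H and realise every sign pattern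
  -- around it.
  let t : κ → ℝ := fun j => ∑ i, (1 / (2 * n)) * v i (x j)
  rw [← Finset.card_univ]
  refine card_le_of_pseudoDim_le hd Finset.univ x t fun u _ => ?_
  obtain ⟨c, hc⟩ := hx fun j => if j ∈ u then 1 else -1
  set K : ℝ := ∑ i, |c i| + 1
  have hK : 0 < K := by positivity
  have hcK : ∀ i, |c i| ≤ K := fun i =>
    (Finset.single_le_sum (f := fun i => |c i|) (fun _ _ => abs_nonneg _)
      (Finset.mem_univ i)).trans (by simp [K])
  -- So small that each perturbed weight stays between 0 and 1/n.
  set η : ℝ := 1 / (2 * n * K)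
  have hη : 0 < η := by positivity
  have hηc : ∀ i, |η * c i| ≤ 1 / (2 * n) := fun i => by
    rw [abs_mul, abs_of_pos hη]
    calc η * |c i| ≤ η * K := by gcongr; exact hcK i
      _ = 1 / (2 * n) := by simp only [η]; field_simp
  let a : κ → ℝ := fun i => 1 / (2 * n) + η * c i
  refine ⟨∑ i, a i • v i, sum_mul_mem_of_convex hH h0 hvH (fun i => ?_) ?_, fun j _ => ?_⟩
  · have := (abs_le.1 (hηc i)).1
    simp only [a]; linarith
  · calc ∑ i, a i ≤ ∑ i : κ, 1 / n := by
          refine Finset.sum_le_sum fun i _ => ?_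
          have := (abs_le.1 (hηc i)).2
          have h2 : 1 / n = 1 / (2 * n) + 1 / (2 * n) := by field_simp; norm_num
          simp only [a]; linarith
      _ = 1 := by simp [← hn]
  · have : (∑ i, a i • v i) (x j) = t j + η * (if j ∈ u then 1 else -1) := by
      rw [← hc j, Finset.mul_sum, ← Finset.sum_add_distrib]
      simp only [Finset.sum_apply, Pi.smul_apply, smul_eq_mul, a]
      exact Finset.sum_congr rfl fun i _ => by ring
    rw [this]
    by_cases hj : j ∈ u
    · simp [hj, hη]
    · simp [hj, hη.le]

/-- A convex family containing `0` of finite pseudo-dimension has a countable subfamily that is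
sequentially dense for pointwise convergence. -/
theorem exists_countable_seq_dense {X : Type*} {H : Set (X → ℝ)} {d : ℕ}
    (hd : pseudoDim H ≤ d) (hH : Convex ℝ H) (h0 : (0 : X → ℝ) ∈ H) :
    ∃ H₀ ⊆ H, H₀.Countable ∧
      ∀ h ∈ H, ∃ g : ℕ → X → ℝ, (∀ n, g n ∈ H₀) ∧ ∀ x, Tendsto (fun n => g n x) atTop (𝓝 (h x)) := by
  classical
  obtain ⟨b, hbH, hspan, hli⟩ := exists_linearIndependent ℝ H
  have hbfin : b.Finite := by
    by_contra hinf
    obtain ⟨s, hsb, hs⟩ := Set.Infinite.exists_subset_card_eq hinf (d + 1)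
    have := card_le_of_linearIndependent hd hH h0 (v := fun i : s => (i : X → ℝ))
      (fun i => hbH (hsb i.2)) (hli.comp (Set.inclusion hsb) (Set.inclusion_injective hsb))
    simp [hs] at this
  have := hbfin.fintype
  let Φ : (b → ℝ) → X → ℝ := fun a => ∑ i, a i • (i : X → ℝ)
  have hΦ : ∀ x, Continuous fun a => Φ a x := fun x => by
    simp only [Φ, Finset.sum_apply, Pi.smul_apply]
    fun_prop
  -- The coefficient vectors of members of H form a separable set, and convergence of coefficients
  -- gives pointwise convergence.
  obtain ⟨C, hCs, hCc, hCd⟩ :=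
    (TopologicalSpace.IsSeparable.of_separableSpace (Φ ⁻¹' H)).exists_countable_dense_subset
  refine ⟨Φ '' C, by rintro _ ⟨a, ha, rfl⟩; exact hCs ha, hCc.image _, fun h hh => ?_⟩
  have hmem : h ∈ Submodule.span ℝ (Set.range ((↑) : b → X → ℝ)) := by
    rw [Subtype.range_coe, hspan]; exact Submodule.subset_span hh
  obtain ⟨a, ha⟩ := (Submodule.mem_span_range_iff_exists_fun ℝ).1 hmem
  have ha' : Φ a = h := ha
  have hacl : a ∈ closure C := hCd (by simpa [ha'] using hh)
  obtain ⟨w, hwC, hw⟩ := mem_closure_iff_seq_limit.1 hacl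
  refine ⟨fun n => Φ (w n), fun n => ⟨w n, hwC n, rfl⟩, fun x => ?_⟩
  rw [← ha']
  exact ((hΦ x).tendsto a).comp hw

/-! ### Exponential moments and McDiarmid's inequality. -/

theorem integrable_of_measurable_of_abs_le {Ω : Type*} [MeasurableSpace Ω] {μ : Measure Ω}
    [IsFiniteMeasure μ] {f : Ω → ℝ} (hf : Measurable f) {K : ℝ} (hK : ∀ x, |f x| ≤ K) :
    Integrable f μ :=
  Integrable.of_bound hf.aestronglyMeasurable K (Eventually.of_forall hK)

/-- Hoeffding's lemma for a function of oscillation at most `c`. -/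
theorem integral_exp_le_of_oscillation {Z : Type*} [MeasurableSpace Z] (μ : Measure Z)
    [IsProbabilityMeasure μ] {g : Z → ℝ} (hg : Measurable g) {c : ℝ}
    (hc : ∀ z z', g z - g z' ≤ c) (t : ℝ) :
    ∫ z, Real.exp (t * g z) ∂μ ≤ Real.exp (t * ∫ z, g z ∂μ + t ^ 2 * c ^ 2 / 8) := by
  have : Nonempty Z := nonempty_of_isProbabilityMeasure μ
  have z₀ : Z := Classical.arbitrary Z
  have hbdd : BddBelow (Set.range g) := ⟨g z₀ - c, by rintro _ ⟨z, rfl⟩; linarith [hc z₀ z]⟩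
  set a := ⨅ z, g z
  have hmem : ∀ z, g z ∈ Set.Icc a (a + c) := fun z => by
    refine ⟨ciInf_le hbdd z, ?_⟩
    have : g z - c ≤ a := le_ciInf fun z' => by linarith [hc z z']
    linarith
  have h := (hasSubgaussianMGF_of_mem_Icc (μ := μ) hg.aemeasurable
    (Eventually.of_forall hmem)).mgf_le t
  have hexp : ∀ z, Real.exp (t * g z)
      = Real.exp (t * ∫ z, g z ∂μ) * Real.exp (t * (g z - ∫ z, g z ∂μ)) := fun z => by
    rw [← Real.exp_add]; congr 1; ring
  simp_rw [hexp]
  rw [integral_const_mul, Real.exp_add]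
  refine mul_le_mul_of_nonneg_left (h.trans (le_of_eq ?_)) (Real.exp_pos _).le
  congr 1
  -- An interval of length c gives variance proxy (c/2)², hence the exponent t²(c/2)²/2.
  simp [div_pow]
  ring

/-- Exponential moment bound for a bounded function of `m` independent coordinates with
coordinatewise oscillation at most `c`. -/
theorem integral_exp_le_of_bounded_differences {Z : Type*} [MeasurableSpace Z] (μ : Measure Z)
    [IsProbabilityMeasure μ] {c : ℝ} (t : ℝ) (m : ℕ) {f : (Fin m → Z) → ℝ} (hf : Measurable f)
    {K : ℝ} (hK : ∀ S, |f S| ≤ K)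
    (hc : ∀ S i z, f S - f (Function.update S i z) ≤ c) :
    ∫ S, Real.exp (t * f S) ∂(Measure.pi fun _ : Fin m => μ)
      ≤ Real.exp (t * ∫ S, f S ∂(Measure.pi fun _ : Fin m => μ) + m * (t ^ 2 * c ^ 2 / 8)) := by
  induction m with
  | zero =>
    have : ∀ S, f S = f default := fun S => by rw [Subsingleton.elim S default]
    simp [this]
  | succ m ih =>
    have hmp := (measurePreserving_piFinSuccAbove (fun _ : Fin (m + 1) => μ) 0).symm
    have hcons : ∀ p : Z × (Fin m → Z),
        (MeasurableEquiv.piFinSuccAbove (fun _ : Fin (m + 1) => Z) 0).symm p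
          = Fin.cons p.1 p.2 := fun p => by
      simp [MeasurableEquiv.piFinSuccAbove, Fin.consEquiv]
    rw [← hmp.integral_comp', ← hmp.integral_comp']
    simp only [hcons]
    have hmeas : Measurable fun p : Z × (Fin m → Z) => f (Fin.cons p.1 p.2) := by
      simp_rw [← hcons]
      exact hf.comp (MeasurableEquiv.measurable _)
    rw [integral_prod _ (integrable_of_measurable_of_abs_le hmeas fun _ => hK _),
      integral_prod _ (integrable_of_measurable_of_abs_le
        (K := Real.exp (|t| * K)) (hmeas.const_mul t).exp fun p => ?_)]
    swap
    · rw [abs_of_pos (Real.exp_pos _)]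
      refine Real.exp_le_exp.2 ((le_abs_self _).trans ?_)
      rw [abs_mul]
      exact mul_le_mul_of_nonneg_left (hK _) (abs_nonneg _)
    -- The conditional mean given the first coordinate keeps oscillation at most c. Hoeffding's
    -- lemma treats it; the inductive hypothesis treats the other coordinates for fixed z.
    set g : Z → ℝ := fun z => ∫ S, f (Fin.cons z S) ∂(Measure.pi fun _ : Fin m => μ) with hg
    have hint : ∀ z, Integrable (fun S : Fin m → Z => f (Fin.cons z S))
        (Measure.pi fun _ : Fin m => μ) := fun z =>
      integrable_of_measurable_of_abs_le (hmeas.comp measurable_prodMk_left) fun _ => hK _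
    have hgmeas : Measurable g :=
      (hmeas.stronglyMeasurable.integral_prod_right (ν := Measure.pi fun _ : Fin m => μ)).measurable
    have hgc : ∀ z z', g z - g z' ≤ c := fun z z' => by
      rw [hg, ← integral_sub (hint z) (hint z')]
      refine (integral_mono ((hint z).sub (hint z')) (integrable_const c) fun S => ?_).trans
        (by simp)
      have := hc (Fin.cons z S) 0 z'
      rwa [Fin.update_cons_zero] at this
    have hgK : ∀ z, |g z| ≤ K := fun z => by
      refine (abs_integral_le_integral_abs).trans ?_
      refine (integral_mono (hint z).abs (integrable_const K) fun S => hK _).trans (by simp)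
    have hstep : ∀ z, ∫ S, Real.exp (t * f (Fin.cons z S)) ∂(Measure.pi fun _ : Fin m => μ)
        ≤ Real.exp (m * (t ^ 2 * c ^ 2 / 8)) * Real.exp (t * g z) := fun z => by
      have := ih (f := fun S => f (Fin.cons z S)) (hmeas.comp measurable_prodMk_left)
        (fun S => hK _) fun S i z' => by
          have := hc (Fin.cons z S) i.succ z'
          rwa [← Fin.cons_update] at this
      rwa [add_comm (t * _), Real.exp_add] at this
    have hexpK : ∀ z, |Real.exp (t * g z)| ≤ Real.exp (|t| * K) := fun z => by
      rw [abs_of_pos (Real.exp_pos _)]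
      refine Real.exp_le_exp.2 ((le_abs_self _).trans ?_)
      rw [abs_mul]
      exact mul_le_mul_of_nonneg_left (hgK _) (abs_nonneg _)
    have hexpint : Integrable (fun z => Real.exp (t * g z)) μ :=
      integrable_of_measurable_of_abs_le (by fun_prop) hexpK
    calc ∫ z, ∫ S, Real.exp (t * f (Fin.cons z S)) ∂(Measure.pi fun _ : Fin m => μ) ∂μ
        ≤ ∫ z, Real.exp (m * (t ^ 2 * c ^ 2 / 8)) * Real.exp (t * g z) ∂μ := by
          refine integral_mono_of_nonneg (Eventually.of_forall fun z => ?_)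
            (hexpint.const_mul _) (Eventually.of_forall hstep)
          exact integral_nonneg fun S => (Real.exp_pos _).le
      _ = Real.exp (m * (t ^ 2 * c ^ 2 / 8)) * ∫ z, Real.exp (t * g z) ∂μ := integral_const_mul _ _
      _ ≤ Real.exp (m * (t ^ 2 * c ^ 2 / 8))
          * Real.exp (t * ∫ z, g z ∂μ + t ^ 2 * c ^ 2 / 8) :=
          mul_le_mul_of_nonneg_left (integral_exp_le_of_oscillation μ hgmeas hgc t)
            (Real.exp_pos _).le
      _ = _ := by
          rw [← Real.exp_add]; congr 1; push_cast; ring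

/-- McDiarmid's inequality, with all oscillations bounded by the same constant. -/
theorem measure_lt_of_bounded_differences {Z : Type*} [MeasurableSpace Z] (μ : Measure Z)
    [IsProbabilityMeasure μ] {c : ℝ} (hc0 : 0 < c) {m : ℕ} (hm : 1 ≤ m) {f : (Fin m → Z) → ℝ}
    (hf : Measurable f) {K : ℝ} (hK : ∀ S, |f S| ≤ K)
    (hc : ∀ S i z, f S - f (Function.update S i z) ≤ c) {s : ℝ} (hs : 0 ≤ s) :
    (Measure.pi fun _ : Fin m => μ)
      {S | ∫ S, f S ∂(Measure.pi fun _ : Fin m => μ) + s < f S}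
      ≤ ENNReal.ofReal (Real.exp (-(2 * s ^ 2 / (m * c ^ 2)))) := by
  set ν := Measure.pi fun _ : Fin m => μ
  have hmpos : (0 : ℝ) < m := by exact_mod_cast hm
  -- This t minimises -ts + m t²c²/8.
  set t : ℝ := 4 * s / (m * c ^ 2) with ht
  have ht0 : 0 ≤ t := by positivity
  have hint : Integrable (fun S => Real.exp (t * f S)) ν :=
    integrable_of_measurable_of_abs_le (K := Real.exp (t * K)) (by fun_prop) fun S => by
      rw [abs_of_pos (Real.exp_pos _)]
      exact Real.exp_le_exp.2 (mul_le_mul_of_nonneg_left ((le_abs_self _).trans (hK S)) ht0)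
  have h1 := measure_ge_le_exp_mul_mgf (μ := ν) (X := f) (∫ S, f S ∂ν + s) ht0 hint
  have h2 : mgf f ν t ≤ _ := integral_exp_le_of_bounded_differences μ t m hf hK hc
  have h3 : ν.real {S | ∫ S, f S ∂ν + s ≤ f S} ≤ Real.exp (-(2 * s ^ 2 / (m * c ^ 2))) := by
    refine h1.trans ((mul_le_mul_of_nonneg_left h2 (Real.exp_pos _).le).trans (le_of_eq ?_))
    rw [← Real.exp_add]
    congr 1
    rw [ht]
    field_simp
    ring
  calc ν {S | ∫ S, f S ∂ν + s < f S} ≤ ν {S | ∫ S, f S ∂ν + s ≤ f S} :=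
        measure_mono fun S hS => by simp only [Set.mem_ofPred_eq] at hS ⊢; exact hS.le
    _ = ENNReal.ofReal (ν.real {S | ∫ S, f S ∂ν + s ≤ f S}) := by
        rw [ofReal_measureReal]
    _ ≤ _ := ENNReal.ofReal_le_ofReal h3

/-! ### Symmetrization. -/

theorem integral_comp_of_measurePreserving {Ω Ω' : Type*} [MeasurableSpace Ω]
    [MeasurableSpace Ω'] {μ : Measure Ω} {ν : Measure Ω'} {φ : Ω → Ω'}
    (hφ : MeasurePreserving φ μ ν) {g : Ω' → ℝ} (hg : Measurable g) :
    ∫ x, g (φ x) ∂μ = ∫ y, g y ∂ν := by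
  rw [← hφ.map_eq, integral_map hφ.aemeasurable hg.aestronglyMeasurable]

section SignedSup

variable {ι Z : Type*} {m : ℕ}

/-- Supremum over a family of the normalised sum with coefficients `s`. -/
noncomputable def signedSup (l : ι → Z → ℝ) (s : Fin m → ℝ) (S : Fin m → Z) : ℝ :=
  ⨆ i, (1 / (m : ℝ)) * ∑ j, s j * l i (S j)

/-- The vector of signs as real numbers. -/
def signVec (σ : Fin m → ℤˣ) (j : Fin m) : ℝ := ((σ j : ℤ) : ℝ)

theorem signVec_cases (σ : Fin m → ℤˣ) (j : Fin m) : signVec σ j = 1 ∨ signVec σ j = -1 := by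
  rcases Int.units_eq_one_or (σ j) with h | h <;> simp [signVec, h]

theorem abs_signVec (σ : Fin m → ℤˣ) (j : Fin m) : |signVec σ j| = 1 := by
  rcases signVec_cases σ j with h | h <;> simp [h]

theorem signVec_neg (σ : Fin m → ℤˣ) : signVec (-σ) = -signVec σ := by
  ext j; simp [signVec]

/-- Average over all sign vectors of the signed suprema. -/
noncomputable def averageSignedSup (l : ι → Z → ℝ) (S : Fin m → Z) : ℝ :=
  ((2 : ℝ) ^ m)⁻¹ * ∑ σ : Fin m → ℤˣ, signedSup l (signVec σ) S

theorem abs_normalised_sum_le (hm : 1 ≤ m) {a : Fin m → ℝ} {K : ℝ} (ha : ∀ j, |a j| ≤ K) :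
    |(1 / (m : ℝ)) * ∑ j, a j| ≤ K := by
  have hmpos : (0 : ℝ) < m := by exact_mod_cast hm
  rw [abs_mul, abs_of_pos (by positivity : (0 : ℝ) < 1 / m)]
  calc (1 / (m : ℝ)) * |∑ j, a j| ≤ (1 / (m : ℝ)) * ∑ j : Fin m, K := by
        gcongr
        exact (Finset.abs_sum_le_sum_abs _ _).trans (Finset.sum_le_sum fun j _ => ha j)
    _ = K := by simp; field_simp

theorem abs_ciSup_le_of_abs_le [Nonempty ι] {f : ι → ℝ} {K : ℝ} (hf : ∀ i, |f i| ≤ K) :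
    |⨆ i, f i| ≤ K := by
  have hb : BddAbove (Set.range f) := ⟨K, by rintro _ ⟨i, rfl⟩; exact (abs_le.1 (hf i)).2⟩
  refine abs_le.2 ⟨?_, ciSup_le fun i => (abs_le.1 (hf i)).2⟩
  obtain ⟨i⟩ := ‹Nonempty ι›
  exact (abs_le.1 (hf i)).1.trans (le_ciSup hb i)

theorem bddAbove_range_of_abs_le {f : ι → ℝ} {K : ℝ} (hf : ∀ i, |f i| ≤ K) :
    BddAbove (Set.range f) := ⟨K, by rintro _ ⟨i, rfl⟩; exact (abs_le.1 (hf i)).2⟩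

theorem abs_signed_sum_le (hm : 1 ≤ m) {l : ι → Z → ℝ} {K : ℝ} (hl : ∀ i z, |l i z| ≤ K)
    {s : Fin m → ℝ} (hs : ∀ j, |s j| = 1) (S : Fin m → Z) (i : ι) :
    |(1 / (m : ℝ)) * ∑ j, s j * l i (S j)| ≤ K :=
  abs_normalised_sum_le hm fun j => by rw [abs_mul, hs, one_mul]; exact hl _ _

variable [MeasurableSpace Z]

theorem measurable_signedSup [Countable ι] {l : ι → Z → ℝ} (hl : ∀ i, Measurable (l i))
    (s : Fin m → ℝ) : Measurable (signedSup l s) :=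
  Measurable.iSup fun i => by
    have := fun j : Fin m => (hl i).comp (measurable_pi_apply (X := fun _ : Fin m => Z) j)
    exact (Finset.measurable_sum _ fun j _ => (this j).const_mul (s j)).const_mul _

theorem integral_normalised_sum (hm : 1 ≤ m) (μ : Measure Z) [IsProbabilityMeasure μ] {f : Z → ℝ}
    (hf : Measurable f) {K : ℝ} (hK : ∀ z, |f z| ≤ K) :
    ∫ S, (1 / (m : ℝ)) * ∑ j, f (S j) ∂(Measure.pi fun _ : Fin m => μ) = ∫ z, f z ∂μ := by
  have hmpos : (0 : ℝ) < m := by exact_mod_cast hm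
  have h : ∀ j : Fin m, ∫ S, f (S j) ∂(Measure.pi fun _ : Fin m => μ) = ∫ z, f z ∂μ := fun j =>
    
    integral_comp_of_measurePreserving (measurePreserving_eval (fun _ : Fin m => μ) j) hf
  rw [integral_const_mul, integral_finsetSum]
  · simp [h]; field_simp
  · exact fun j _ => integrable_of_measurable_of_abs_le (hf.comp (measurable_pi_apply j))
      fun _ => hK _

/-- Symmetrization: the expected uniform deviation over a countable family of bounded functions
is at most twice its Rademacher average. -/
theorem integral_deviation_le [Countable ι] [Nonempty ι] (hm : 1 ≤ m) (μ : Measure Z)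
    [IsProbabilityMeasure μ] {l : ι → Z → ℝ} (hl : ∀ i, Measurable (l i)) {K : ℝ}
    (hK : ∀ i z, |l i z| ≤ K) :
    ∫ S, (⨆ i, ((∫ z, l i z ∂μ) - (1 / (m : ℝ)) * ∑ j, l i (S j)))
        ∂(Measure.pi fun _ : Fin m => μ)
      ≤ 2 * ∫ S, averageSignedSup l S ∂(Measure.pi fun _ : Fin m => μ) := by
  classical
  set ν := Measure.pi fun _ : Fin m => μ with hν
  -- Pairs of a sample point and an independent ghost point; swapping a pair changes the sign.
  let l2 : ι → Z × Z → ℝ := fun i p => l i p.2 - l i p.1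
  have hl2 : ∀ i, Measurable (l2 i) := fun i =>
    ((hl i).comp measurable_snd).sub ((hl i).comp measurable_fst)
  have hK2 : ∀ i p, |l2 i p| ≤ K + K := fun i p =>
    (abs_sub _ _).trans (add_le_add (hK _ _) (hK _ _))
  let F : (Fin m → Z × Z) → ℝ := signedSup l2 1
  have hFK : ∀ s : Fin m → ℝ, (∀ j, |s j| = 1) → ∀ W, |signedSup l2 s W| ≤ K + K :=
    fun s hs W => abs_ciSup_le_of_abs_le fun i => abs_signed_sum_le hm hK2 hs W i
  have hAK : ∀ s : Fin m → ℝ, (∀ j, |s j| = 1) → ∀ S, |signedSup l s S| ≤ K :=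
    fun s hs S => abs_ciSup_le_of_abs_le fun i => abs_signed_sum_le hm hK hs S i
  have hone : ∀ j : Fin m, |(1 : Fin m → ℝ) j| = 1 := fun j => by simp
  let e := MeasurableEquiv.arrowProdEquivProdArrow Z Z (Fin m)
  have he : MeasurePreserving e (Measure.pi fun _ : Fin m => μ.prod μ) (ν.prod ν) :=
    measurePreserving_arrowProdEquivProdArrow Z Z (Fin m) (fun _ => μ) (fun _ => μ)
  have hesymm : ∀ p : (Fin m → Z) × (Fin m → Z), e.symm p = fun j => (p.1 j, p.2 j) :=
    fun p => rfl
  have hFe : Measurable fun p : (Fin m → Z) × (Fin m → Z) => F (e.symm p) :=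
    (measurable_signedSup hl2 1).comp e.symm.measurable
  have hFint : Integrable (fun p : (Fin m → Z) × (Fin m → Z) => F (e.symm p)) (ν.prod ν) :=
    integrable_of_measurable_of_abs_le hFe fun p => hFK 1 hone _
  have hemp : ∀ i, Measurable fun S : Fin m → Z => (1 / (m : ℝ)) * ∑ j, l i (S j) := fun i =>
    (Finset.measurable_sum _ fun j _ => (hl i).comp (measurable_pi_apply j)).const_mul _
  have hempint : ∀ i, Integrable (fun S : Fin m → Z => (1 / (m : ℝ)) * ∑ j, l i (S j)) ν :=
    fun i => integrable_of_measurable_of_abs_le (hemp i)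
      fun S => abs_normalised_sum_le hm fun j => hK i (S j)
  have hmulK : ∀ i, |∫ z, l i z ∂μ| ≤ K := fun i =>
    abs_integral_le_integral_abs.trans ((integral_mono
      (integrable_of_measurable_of_abs_le (hl i) (hK i)).abs (integrable_const K)
      fun z => hK i z).trans (by simp))
  -- comparison with a second independent sample
  have h1 : ∀ S, (⨆ i, ((∫ z, l i z ∂μ) - (1 / (m : ℝ)) * ∑ j, l i (S j)))
      ≤ ∫ S', F (e.symm (S, S')) ∂ν := fun S => by
    refine ciSup_le fun i => ?_
    rw [← integral_normalised_sum hm μ (hl i) (hK i), ← hν]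
    have : (1 / (m : ℝ)) * ∑ j, l i (S j) = ∫ _, (1 / (m : ℝ)) * ∑ j, l i (S j) ∂ν := by simp
    rw [this, ← integral_sub (hempint i) (integrable_const _)]
    refine integral_mono ((hempint i).sub (integrable_const _))
      (integrable_of_measurable_of_abs_le (hFe.comp measurable_prodMk_left)
        fun p => hFK 1 hone _) fun S' => ?_
    refine le_of_eq_of_le ?_ (le_ciSup (bddAbove_range_of_abs_le fun i =>
      abs_signed_sum_le hm hK2 hone (e.symm (S, S')) i) i)
    simp [hesymm, l2, ← mul_sub, Finset.sum_sub_distrib]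
  have hPhi : ∫ S, (⨆ i, ((∫ z, l i z ∂μ) - (1 / (m : ℝ)) * ∑ j, l i (S j))) ∂ν
      ≤ ∫ W, F W ∂(Measure.pi fun _ : Fin m => μ.prod μ) := by
    rw [← he.symm.integral_comp', integral_prod _ hFint]
    refine integral_mono ?_ hFint.integral_prod_left h1
    refine integrable_of_measurable_of_abs_le (K := K + K)
      (Measurable.iSup fun i => measurable_const.sub (hemp i)) fun S => ?_
    exact abs_ciSup_le_of_abs_le fun i => (abs_sub _ _).trans
      (add_le_add (hmulK i) (abs_normalised_sum_le hm fun j => hK i (S j)))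
  -- coordinates may be exchanged
  have hswap : ∀ σ : Fin m → ℤˣ, ∫ W, F W ∂(Measure.pi fun _ : Fin m => μ.prod μ)
      ≤ ∫ S, signedSup l (signVec σ) S ∂ν + ∫ S, signedSup l (signVec (-σ)) S ∂ν := fun σ => by
    -- Swapping exactly the pairs with σ j = -1 preserves the product measure and inserts the signs
    -- σ.
    let T : Fin m → Z × Z → Z × Z := fun j => if σ j = 1 then id else Prod.swap
    have hT : MeasurePreserving (fun (W : Fin m → Z × Z) j => T j (W j))
        (Measure.pi fun _ : Fin m => μ.prod μ) (Measure.pi fun _ : Fin m => μ.prod μ) :=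
      measurePreserving_pi _ _ fun j => by
        by_cases h : σ j = 1
        · simpa [T, h] using MeasurePreserving.id (μ.prod μ)
        · simpa [T, h] using Measure.measurePreserving_swap
    have hFT : ∀ W : Fin m → Z × Z, F (fun j => T j (W j)) = signedSup l2 (signVec σ) W :=
      fun W => by
        simp only [F, signedSup]
        congr 1; ext i; congr 1
        refine Finset.sum_congr rfl fun j _ => ?_
        rcases Int.units_eq_one_or (σ j) with h | h <;> simp [signVec, h, T, l2]
    rw [← integral_comp_of_measurePreserving (g := F) hT (measurable_signedSup hl2 1)]
    simp_rw [hFT]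
    rw [← he.symm.integral_comp']
    have hfst := (measurePreserving_fst (μ := ν) (ν := ν))
    have hsnd := (measurePreserving_snd (μ := ν) (ν := ν))
    rw [← integral_comp_of_measurePreserving hsnd (measurable_signedSup hl (signVec σ)),
      ← integral_comp_of_measurePreserving hfst (measurable_signedSup hl (signVec (-σ))), ← integral_add]
    rotate_left
    · exact integrable_of_measurable_of_abs_le ((measurable_signedSup hl _).comp measurable_snd)
        fun p => hAK _ (abs_signVec σ) _
    · exact integrable_of_measurable_of_abs_le ((measurable_signedSup hl _).comp measurable_fst)
        fun p => hAK _ (abs_signVec (-σ)) _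
    refine integral_mono ?_ ?_ fun p => ?_
    · exact integrable_of_measurable_of_abs_le
        ((measurable_signedSup hl2 _).comp e.symm.measurable) fun p => hFK _ (abs_signVec σ) _
    · exact (integrable_of_measurable_of_abs_le ((measurable_signedSup hl _).comp measurable_snd)
        fun p => hAK _ (abs_signVec σ) _).add (integrable_of_measurable_of_abs_le
          ((measurable_signedSup hl _).comp measurable_fst) fun p => hAK _ (abs_signVec (-σ)) _)
    · refine ciSup_le fun i => ?_
      have e1 := le_ciSup (bddAbove_range_of_abs_le fun i =>
        abs_signed_sum_le hm hK (abs_signVec σ) p.2 i) i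
      have e2 := le_ciSup (bddAbove_range_of_abs_le fun i =>
        abs_signed_sum_le hm hK (abs_signVec (-σ)) p.1 i) i
      refine le_of_eq_of_le ?_ (add_le_add e1 e2)
      change (1 / (m : ℝ)) * ∑ j, signVec σ j * (l i (p.2 j) - l i (p.1 j)) = _
      rw [← mul_add, ← Finset.sum_add_distrib, signVec_neg]
      congr 1
      exact Finset.sum_congr rfl fun j _ => by simp; ring
  have hcard : ((Finset.univ : Finset (Fin m → ℤˣ)).card : ℝ) = 2 ^ m := by
    simp
  have hpow : (0 : ℝ) < 2 ^ m := by positivity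
  refine hPhi.trans ?_
  have hsum := Finset.sum_le_sum fun σ (_ : σ ∈ (Finset.univ : Finset (Fin m → ℤˣ))) => hswap σ
  -- Negation permutes the sign vectors, so both samples contribute the same average; this is the
  -- factor 2.
  have hneg := Equiv.sum_comp (Equiv.neg (Fin m → ℤˣ))
    fun σ => ∫ S, signedSup l (signVec σ) S ∂ν
  simp only [Equiv.neg_apply] at hneg
  rw [Finset.sum_const, nsmul_eq_mul, hcard, Finset.sum_add_distrib, hneg] at hsum
  have havg : ∫ S, averageSignedSup l S ∂ν
      = ((2 : ℝ) ^ m)⁻¹ * ∑ σ : Fin m → ℤˣ, ∫ S, signedSup l (signVec σ) S ∂ν := by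
    simp only [averageSignedSup]
    rw [integral_const_mul, integral_finsetSum]
    exact fun σ _ => integrable_of_measurable_of_abs_le (measurable_signedSup hl _)
      (hAK _ (abs_signVec σ))
  rw [havg]
  rw [← mul_assoc, mul_comm (2 : ℝ), mul_assoc, le_inv_mul_iff₀ hpow]
  linarith

end SignedSup

/-! ### Talagrand's contraction principle. -/

section Contraction

variable {ι : Type*} [Nonempty ι] {m : ℕ}

/-- Matching the signs of `a` turns the signed sum into ∑ |a j|. In this way finite empirical
Rademacher complexity bounds the hypotheses on the sample, as contraction of real-valued suprema
requires. -/
theorem abs_le_of_signed_sums_le {a : Fin m → ℝ} {K : ℝ}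
    (h : ∀ σ : Fin m → ℤˣ, ∑ j, signVec σ j * a j ≤ K) (j : Fin m) : |a j| ≤ K := by
  classical
  have h1 := h fun j => if 0 ≤ a j then 1 else -1
  refine le_trans ?_ h1
  have : ∀ j, signVec (fun j => if 0 ≤ a j then (1 : ℤˣ) else -1) j * a j = |a j| := fun j => by
    by_cases hj : 0 ≤ a j
    · simp [signVec, hj, abs_of_nonneg]
    · simp [signVec, hj, abs_of_neg (not_le.1 hj)]
  simp_rw [this]
  exact Finset.single_le_sum (f := fun j => |a j|) (fun _ _ => abs_nonneg _) (Finset.mem_univ j)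

theorem abs_signed_sum_le_sum {a : Fin m → ℝ} {K : ℝ} (h : ∀ j, |a j| ≤ K) (σ : Fin m → ℤˣ) :
    |∑ j, signVec σ j * a j| ≤ m * K := by
  refine (Finset.abs_sum_le_sum_abs _ _).trans ((Finset.sum_le_sum (g := fun _ => K)
    fun j _ => ?_).trans (by simp))
  rw [abs_mul, abs_signVec, one_mul]
  exact h j

/-- Two suprema with opposite signs of one summand decrease when that summand is contracted. -/
theorem ciSup_add_ciSup_le_of_contraction {A v w : ι → ℝ} {K : ℝ} (hA : ∀ i, |A i| ≤ K)
    (hv : ∀ i, |v i| ≤ K) (hvw : ∀ i k, |w i - w k| ≤ |v i - v k|) :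
    (⨆ i, (A i + w i)) + (⨆ i, (A i - w i)) ≤ (⨆ i, (A i + v i)) + ⨆ i, (A i - v i) := by
  have b1 : BddAbove (Set.range fun i => A i + v i) := bddAbove_range_of_abs_le (K := K + K)
    fun i => (abs_add_le _ _).trans (add_le_add (hA i) (hv i))
  have b2 : BddAbove (Set.range fun i => A i - v i) := bddAbove_range_of_abs_le (K := K + K)
    fun i => (abs_sub _ _).trans (add_le_add (hA i) (hv i))
  rw [← le_sub_iff_add_le]
  refine ciSup_le fun i => ?_
  rw [le_sub_comm]
  refine ciSup_le fun k => ?_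
  have h := (le_abs_self _).trans (hvw i k)
  -- The sign of v i - v k decides which index is tested in which supremum.
  rcases abs_cases (v i - v k) with ⟨h1, -⟩ | ⟨h1, -⟩
  · have := le_ciSup b1 i
    have := le_ciSup b2 k
    linarith
  · have := le_ciSup b1 k
    have := le_ciSup b2 i
    linarith

/-- Contracting one coordinate decreases the sum of the signed suprema. -/
theorem sum_ciSup_le_of_contraction_at {v w : ι → Fin m → ℝ} {K : ℝ} (hv : ∀ i j, |v i j| ≤ K)
    (j₀ : Fin m) (hne : ∀ i j, j ≠ j₀ → w i j = v i j)
    (hvw : ∀ i k, |w i j₀ - w k j₀| ≤ |v i j₀ - v k j₀|) :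
    ∑ σ : Fin m → ℤˣ, ⨆ i, ∑ j, signVec σ j * w i j
      ≤ ∑ σ : Fin m → ℤˣ, ⨆ i, ∑ j, signVec σ j * v i j := by
  classical
  have hflip : Function.Involutive fun σ : Fin m → ℤˣ => Function.update σ j₀ (-σ j₀) :=
    fun σ => by simp
  -- Pairing σ with its flip at j₀ counts every sign vector twice and leaves a two-supremum
  -- inequality for each pair.
  have hsum : ∀ F : (Fin m → ℤˣ) → ℝ,
      ∑ σ, (F σ + F (Function.update σ j₀ (-σ j₀))) = 2 * ∑ σ, F σ := fun F => by
    rw [Finset.sum_add_distrib]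
    have := Equiv.sum_comp (hflip.toPerm _) F
    simp only [Function.Involutive.coe_toPerm] at this
    rw [this]; ring
  have key : ∀ σ : Fin m → ℤˣ, σ j₀ = 1 →
      (⨆ i, ∑ j, signVec σ j * w i j)
          + (⨆ i, ∑ j, signVec (Function.update σ j₀ (-σ j₀)) j * w i j)
        ≤ (⨆ i, ∑ j, signVec σ j * v i j)
          + ⨆ i, ∑ j, signVec (Function.update σ j₀ (-σ j₀)) j * v i j := fun σ hσ => by
    let A : ι → ℝ := fun i => ∑ j ∈ Finset.univ.erase j₀, signVec σ j * v i j
    have e1 : ∀ u : ι → Fin m → ℝ, (∀ i j, j ≠ j₀ → u i j = v i j) → ∀ i,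
        ∑ j, signVec σ j * u i j = A i + u i j₀ := fun u hu i => by
      rw [← Finset.sum_erase_add _ _ (Finset.mem_univ j₀)]
      congr 1
      · exact Finset.sum_congr rfl fun j hj => by rw [hu i j (Finset.ne_of_mem_erase hj)]
      · simp [signVec, hσ]
    have e2 : ∀ u : ι → Fin m → ℝ, (∀ i j, j ≠ j₀ → u i j = v i j) → ∀ i,
        ∑ j, signVec (Function.update σ j₀ (-σ j₀)) j * u i j = A i - u i j₀ := fun u hu i => by
      rw [← Finset.sum_erase_add _ _ (Finset.mem_univ j₀), sub_eq_add_neg]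
      congr 1
      · refine Finset.sum_congr rfl fun j hj => ?_
        rw [hu i j (Finset.ne_of_mem_erase hj)]
        simp [signVec, Function.update_of_ne (Finset.ne_of_mem_erase hj)]
      · simp [signVec, hσ]
    simp_rw [e1 w hne, e2 w hne, e1 v (fun _ _ _ => rfl), e2 v (fun _ _ _ => rfl)]
    refine ciSup_add_ciSup_le_of_contraction (K := m * K + K) (fun i => ?_) (fun i => ?_) hvw
    · have h1 := abs_signed_sum_le_sum (hv i) σ
      rw [e1 v (fun _ _ _ => rfl)] at h1
      have h2 := abs_sub (A i + v i j₀) (v i j₀)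
      rw [add_sub_cancel_right] at h2
      linarith [hv i j₀]
    · have : 0 ≤ K := (abs_nonneg _).trans (hv i j₀)
      have : (0 : ℝ) ≤ m * K := by positivity
      linarith [hv i j₀]
  have h2 : 2 * ∑ σ : Fin m → ℤˣ, ⨆ i, ∑ j, signVec σ j * w i j
      ≤ 2 * ∑ σ : Fin m → ℤˣ, ⨆ i, ∑ j, signVec σ j * v i j := by
    rw [← hsum, ← hsum]
    refine Finset.sum_le_sum fun σ _ => ?_
    rcases Int.units_eq_one_or (σ j₀) with h | h
    · exact key σ h
    · have := key (Function.update σ j₀ (-σ j₀)) (by simp [h])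
      have hinv : Function.update (Function.update σ j₀ (-σ j₀)) j₀
          (-(Function.update σ j₀ (-σ j₀)) j₀) = σ := hflip σ
      rw [hinv] at this
      linarith
  linarith

/-- Talagrand's contraction principle for finitely many coordinates. -/
theorem sum_ciSup_le_of_contraction {u w : ι → Fin m → ℝ} {K : ℝ} (hu : ∀ i j, |u i j| ≤ K)
    (hw : ∀ i j, |w i j| ≤ K) (huw : ∀ i k j, |w i j - w k j| ≤ |u i j - u k j|) :
    ∑ σ : Fin m → ℤˣ, ⨆ i, ∑ j, signVec σ j * w i j
      ≤ ∑ σ : Fin m → ℤˣ, ⨆ i, ∑ j, signVec σ j * u i j := by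
  classical
  -- Interpolation: the coordinates in `s` are already contracted.
  have h : ∀ s : Finset (Fin m),
      ∑ σ : Fin m → ℤˣ, ⨆ i, ∑ j, signVec σ j * (if j ∈ s then w i j else u i j)
        ≤ ∑ σ : Fin m → ℤˣ, ⨆ i, ∑ j, signVec σ j * u i j := fun s => by
    induction s using Finset.induction_on with
    | empty => simp
    | insert a s ha ih =>
      refine le_trans ?_ ih
      refine sum_ciSup_le_of_contraction_at (K := K) (fun i j => ?_) a (fun i j hj => ?_)
        fun i k => ?_
      · split_ifs
        · exact hw i j
        · exact hu i j
      · simp [hj]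
      · simpa [ha] using huw i k a
  simpa using h Finset.univ

end Contraction

/-! ### Massart's finite class lemma. -/

section Massart

variable {ι : Type*} [Nonempty ι] {m : ℕ}

/-- The optimal t is √(2L)/R. It degenerates for L = 0, where t = x/R² excludes x > 0 instead. -/
theorem le_mul_sqrt_of_forall_le {x L R : ℝ} (hL : 0 ≤ L) (hR : 0 < R)
    (h : ∀ t : ℝ, 0 < t → x ≤ L / t + t * R ^ 2 / 2) : x ≤ R * √(2 * L) := by
  rcases hL.eq_or_lt with rfl | hL
  · simp only [mul_zero, Real.sqrt_zero]
    by_contra! hx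
    have := h (x / R ^ 2) (by positivity)
    have h2 : x / R ^ 2 * R ^ 2 = x := by field_simp
    rw [h2] at this
    simp at this
    linarith
  · have hs : 0 < √(2 * L) := by positivity
    have h1 := h (√(2 * L) / R) (by positivity)
    have hsq : √(2 * L) ^ 2 = 2 * L := Real.sq_sqrt (by positivity)
    refine h1.trans (le_of_eq ?_)
    have : L = √(2 * L) ^ 2 / 2 := by linarith
    generalize √(2 * L) = s at *
    subst this
    field_simp
    ring

theorem sum_exp_signed_sum (a : Fin m → ℝ) :
    ∑ σ : Fin m → ℤˣ, Real.exp (∑ j, signVec σ j * a j) = ∏ j, (2 * Real.cosh (a j)) := by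
  have h : ∀ σ : Fin m → ℤˣ, Real.exp (∑ j, signVec σ j * a j)
      = ∏ j, Real.exp (((σ j : ℤ) : ℝ) * a j) := fun σ => by rw [Real.exp_sum]; rfl
  simp_rw [h]
  rw [← Fintype.prod_sum (fun j (s : ℤˣ) => Real.exp (((s : ℤ) : ℝ) * a j))]
  refine Finset.prod_congr rfl fun j _ => ?_
  rw [Real.cosh_eq]
  have : (Finset.univ : Finset ℤˣ) = {1, -1} := rfl
  rw [this, Finset.sum_pair (by decide)]
  simp
  ring

/-- Massart's lemma: `a` takes values in a finite set of vectors. -/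
theorem average_ciSup_le_of_finite {a : ι → Fin m → ℝ} {V : Finset (Fin m → ℝ)} {L K : ℝ}
    (haV : ∀ i, a i ∈ V) (hVL : (V.card : ℝ) ≤ Real.exp L) (hL : 0 ≤ L) (hK : 0 < K)
    (hm : 1 ≤ m) (hVK : ∀ v ∈ V, ∀ j, |v j| ≤ K) :
    ((2 : ℝ) ^ m)⁻¹ * ∑ σ : Fin m → ℤˣ, ⨆ i, ∑ j, signVec σ j * a i j
      ≤ K * √m * √(2 * L) := by
  classical
  have hmpos : (0 : ℝ) < m := by exact_mod_cast hm
  have hpow : (0 : ℝ) < 2 ^ m := by positivity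
  refine le_mul_sqrt_of_forall_le hL (by positivity) fun t ht => ?_
  set p : (Fin m → ℤˣ) → ℝ := fun σ => ⨆ i, ∑ j, signVec σ j * a i j with hp
  have hjensen := convexOn_exp.map_sum_le (t := (Finset.univ : Finset (Fin m → ℤˣ)))
    (w := fun _ => ((2 : ℝ) ^ m)⁻¹) (p := fun σ => t * p σ) (fun _ _ => by positivity)
    (by simp) (fun _ _ => Set.mem_univ _)
  simp only [smul_eq_mul] at hjensen
  rw [← Finset.mul_sum, ← Finset.mul_sum, ← Finset.mul_sum] at hjensen
  have hpexp : ∀ σ, Real.exp (t * p σ) ≤ ∑ v ∈ V, Real.exp (∑ j, signVec σ j * (t * v j)) :=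
    fun σ => by
    -- Only finitely many vectors occur, so the supremum is attained and its exponential is one term
    -- of the sum over V.
    have hbd : p σ ∈ Set.range fun i => ∑ j, signVec σ j * a i j := by
      have hfin : (Set.range fun i => ∑ j, signVec σ j * a i j).Finite :=
        (V.finite_toSet.image fun v => ∑ j, signVec σ j * v j).subset (by
          rintro _ ⟨i, rfl⟩; exact ⟨a i, haV i, rfl⟩)
      exact (Set.range_nonempty _).csSup_mem hfin
    obtain ⟨i, hi⟩ := hbd
    refine le_trans (le_of_eq ?_) (Finset.single_le_sum
      (f := fun v => Real.exp (∑ j, signVec σ j * (t * v j)))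
      (fun _ _ => (Real.exp_pos _).le) (haV i))
    rw [← hi, Finset.mul_sum]
    congr 1
    exact Finset.sum_congr rfl fun j _ => by ring
  have hv : ∀ v ∈ V, ∑ σ : Fin m → ℤˣ, Real.exp (∑ j, signVec σ j * (t * v j))
      ≤ 2 ^ m * Real.exp (m * (t ^ 2 * K ^ 2 / 2)) := fun v hv => by
    rw [sum_exp_signed_sum, Finset.prod_mul_distrib]
    simp only [Finset.prod_const, Finset.card_univ, Fintype.card_fin]
    refine mul_le_mul_of_nonneg_left ?_ hpow.le
    calc ∏ j, Real.cosh (t * v j) ≤ ∏ _j : Fin m, Real.exp (t ^ 2 * K ^ 2 / 2) := by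
          refine Finset.prod_le_prod (fun _ _ => (Real.cosh_pos _).le) fun j _ => ?_
          refine (Real.cosh_le_exp_half_sq _).trans (Real.exp_le_exp.2 ?_)
          rw [mul_pow]
          have := sq_le_sq' (abs_le.1 (hVK v hv j)).1 (abs_le.1 (hVK v hv j)).2
          gcongr
      _ = _ := by
          rw [Finset.prod_const, ← Real.exp_nat_mul]; simp
  have hfinal : Real.exp (t * (((2 : ℝ) ^ m)⁻¹ * ∑ σ, p σ))
      ≤ Real.exp (L + m * (t ^ 2 * K ^ 2 / 2)) := by
    calc Real.exp (t * (((2 : ℝ) ^ m)⁻¹ * ∑ σ, p σ))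
        = Real.exp (((2 : ℝ) ^ m)⁻¹ * (t * ∑ σ, p σ)) := by congr 1; ring
      _ ≤ ((2 : ℝ) ^ m)⁻¹ * ∑ σ, Real.exp (t * p σ) := hjensen
      _ ≤ ((2 : ℝ) ^ m)⁻¹ * ∑ σ, ∑ v ∈ V, Real.exp (∑ j, signVec σ j * (t * v j)) := by
          gcongr with σ
          exact hpexp σ
      _ = ((2 : ℝ) ^ m)⁻¹ * ∑ v ∈ V, ∑ σ : Fin m → ℤˣ, Real.exp (∑ j, signVec σ j * (t * v j)) := by
          rw [Finset.sum_comm]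
      _ ≤ ((2 : ℝ) ^ m)⁻¹ * ∑ v ∈ V, 2 ^ m * Real.exp (m * (t ^ 2 * K ^ 2 / 2)) := by
          gcongr with v hvV
          exact hv v hvV
      _ = V.card * Real.exp (m * (t ^ 2 * K ^ 2 / 2)) := by
          rw [Finset.sum_const, nsmul_eq_mul]; field_simp
      _ ≤ Real.exp L * Real.exp (m * (t ^ 2 * K ^ 2 / 2)) := by gcongr
      _ = _ := (Real.exp_add _ _).symm
  have h3 := Real.exp_le_exp.1 hfinal
  have hsq : √(m : ℝ) ^ 2 = m := Real.sq_sqrt hmpos.le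
  rw [mul_pow, hsq]
  have h4 : t * (L / t + t * (K ^ 2 * m) / 2) = L + m * (t ^ 2 * K ^ 2 / 2) := by
    field_simp
  rw [← h4] at h3
  exact le_of_mul_le_mul_left h3 ht

end Massart

/-! ### Sauer–Shelah bound for threshold traces. -/

section SauerShelah

/-- The Sauer–Shelah bound in exponential form. -/
theorem sum_choose_le_exp {d m : ℕ} (hdm : d ≤ m) :
    ∑ k ∈ Finset.Iic d, (m.choose k : ℝ) ≤ Real.exp (d * Real.log (Real.exp 1 * m / d)) := by
  rcases Nat.eq_zero_or_pos d with rfl | hd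
  · simp [show Finset.Iic 0 = {0} from rfl]
  have hd' : (0 : ℝ) < d := by exact_mod_cast hd
  have hm' : (0 : ℝ) < m := by exact_mod_cast hd.trans_le hdm
  have hle : (d : ℝ) / m ≤ 1 := by rw [div_le_one hm']; exact_mod_cast hdm
  -- As d/m ≤ 1, the factor (d/m)^d is at most (d/m)^k for k ≤ d, and the binomial theorem bounds
  -- the sum by (1 + d/m)^m ≤ e^d.
  have h1 : (∑ k ∈ Finset.Iic d, (m.choose k : ℝ)) * ((d : ℝ) / m) ^ d ≤ Real.exp d := by
    calc (∑ k ∈ Finset.Iic d, (m.choose k : ℝ)) * ((d : ℝ) / m) ^ d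
        ≤ ∑ k ∈ Finset.Iic d, ((d : ℝ) / m) ^ k * m.choose k := by
          rw [Finset.sum_mul]
          refine Finset.sum_le_sum fun k hk => ?_
          rw [mul_comm]
          gcongr ?_ * _
          exact pow_le_pow_of_le_one (by positivity) hle (Finset.mem_Iic.1 hk)
      _ ≤ ∑ k ∈ Finset.range (m + 1), ((d : ℝ) / m) ^ k * m.choose k := by
          refine Finset.sum_le_sum_of_subset_of_nonneg (fun k hk => ?_) fun _ _ _ => by positivity
          have := Finset.mem_Iic.1 hk
          exact Finset.mem_range.2 (by omega)
      _ = ((d : ℝ) / m + 1) ^ m := by rw [add_pow]; simp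
      _ ≤ Real.exp (d / m) ^ m := by
          gcongr
          exact Real.add_one_le_exp _
      _ = Real.exp d := by rw [← Real.exp_nat_mul]; congr 1; field_simp
  have h2 : Real.exp (d * Real.log (Real.exp 1 * m / d))
      = Real.exp d * ((m : ℝ) / d) ^ d := by
    rw [Real.exp_nat_mul, Real.exp_log (by positivity), mul_div_assoc, mul_pow, ← Real.exp_nat_mul,
      mul_one]
  rw [h2]
  have h3 : ((d : ℝ) / m) ^ d * ((m : ℝ) / d) ^ d = 1 := by
    rw [← mul_pow]; field_simp; simp
  calc ∑ k ∈ Finset.Iic d, (m.choose k : ℝ)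
      = (∑ k ∈ Finset.Iic d, (m.choose k : ℝ)) * ((d : ℝ) / m) ^ d * ((m : ℝ) / d) ^ d := by
        rw [mul_assoc, h3, mul_one]
    _ ≤ _ := by gcongr

open Classical in
/-- The sets cut out on a sample by thresholds of a family of pseudo-dimension at most `d`. -/
theorem card_threshold_traces_le {X : Type*} {H : Set (X → ℝ)} {d m : ℕ}
    (hd : pseudoDim H ≤ d) (hdm : d ≤ m) (x : Fin m → X) (t : Fin m → ℝ) :
    ((Finset.univ.filter fun u : Finset (Fin m) =>
      ∃ h ∈ H, u = Finset.univ.filter fun j => t j < h (x j)).card : ℝ)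
      ≤ Real.exp (d * Real.log (Real.exp 1 * m / d)) := by
  set 𝒜 := Finset.univ.filter fun u : Finset (Fin m) =>
      ∃ h ∈ H, u = Finset.univ.filter fun j => t j < h (x j)
  have hvc : 𝒜.vcDim ≤ d := Finset.sup_le fun s hs => by
    have hs' := Finset.mem_shatterer.1 hs
    refine card_le_of_pseudoDim_le hd s x t fun u hu => ?_
    obtain ⟨w, hw, hwu⟩ := hs' hu
    obtain ⟨h, hH, rfl⟩ := (Finset.mem_filter.1 hw).2
    refine ⟨h, hH, fun i hi => ?_⟩
    rw [← hwu]
    simp [hi]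
  have h1 := 𝒜.card_le_card_shatterer.trans Finset.card_shatterer_le_sum_vcDim
  rw [Fintype.card_fin] at h1
  refine le_trans ?_ (sum_choose_le_exp hdm)
  have h2 : ∑ k ∈ Finset.Iic 𝒜.vcDim, m.choose k ≤ ∑ k ∈ Finset.Iic d, m.choose k :=
    Finset.sum_le_sum_of_subset (Finset.Iic_subset_Iic.2 hvc)
  exact_mod_cast h1.trans h2

end SauerShelah

/-! ### Pointwise properties of the two losses. -/

section Losses

theorem loss_mem_Icc {M r : ℝ} {b : ℝ × ℝ} (h0 : 0 ≤ b.2) (h1 : b.2 ≤ b.1) (hM : b.1 ≤ M) :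
    loss r b ∈ Set.Icc (-M) 0 := by
  unfold loss revenue
  constructor <;> split_ifs <;> grind

theorem loss_eq_of_lt {r : ℝ} {b : ℝ × ℝ} (h1 : b.2 ≤ b.1) (hr : b.1 < r) : loss r b = 0 := by
  unfold loss revenue
  split_ifs <;> grind

theorem loss_eq_of_le {r : ℝ} {b : ℝ × ℝ} (hr : r ≤ b.1) : loss r b = -max r b.2 := by
  unfold loss revenue
  split_ifs <;> grind

theorem neg_fst_le_loss {r : ℝ} {b : ℝ × ℝ} (h0 : 0 ≤ b.2) (h1 : b.2 ≤ b.1) :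
    -b.1 ≤ loss r b := (loss_mem_Icc h0 h1 le_rfl).1

/-- The continuous part of the loss. -/
theorem loss_sub_indicator {r : ℝ} {b : ℝ × ℝ} (h1 : b.2 ≤ b.1) :
    loss r b - (if b.1 < r then b.1 else 0) = -max (min r b.1) b.2 := by
  by_cases h : b.1 < r
  · rw [loss_eq_of_lt h1 h, if_pos h, min_eq_right h.le, max_eq_left h1]; ring
  · rw [loss_eq_of_le (not_lt.1 h), if_neg h, min_eq_left (not_lt.1 h)]; ring

/-- The Lipschitz constant 1 here lets the contraction principle compare the clipped loss with the
hypotheses themselves. -/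
theorem abs_clip_sub_clip_le (r r' a b : ℝ) :
    |-max (min r a) b - -max (min r' a) b| ≤ |r - r'| := by
  rw [neg_sub_neg, abs_sub_comm]
  refine (abs_max_sub_max_le_abs _ _ _).trans ((abs_min_sub_min_le_max _ _ _ _).trans ?_)
  simp

theorem surrogateLoss_mem_Icc {γ M r : ℝ} (hγ : 0 < γ) {b : ℝ × ℝ} (h0 : 0 ≤ b.2)
    (h1 : b.2 ≤ b.1) (hM : b.1 ≤ M) : surrogateLoss γ r b ∈ Set.Icc (-M) 0 := by
  have key : b.1 < r → r ≤ (1 + γ) * b.1 →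
      -M ≤ 1 / γ * (r - (1 + γ) * b.1) ∧ 1 / γ * (r - (1 + γ) * b.1) ≤ 0 := fun h2 h3 => by
    have e : 1 / γ * (r - (1 + γ) * b.1) = (r - b.1) / γ - b.1 := by field_simp; ring
    refine ⟨?_, mul_nonpos_of_nonneg_of_nonpos (by positivity) (by linarith)⟩
    rw [e]
    have : 0 ≤ (r - b.1) / γ := div_nonneg (by linarith) hγ.le
    linarith
  unfold surrogateLoss
  constructor <;> split_ifs <;> grind

/-- The two differ only on the ramp, where the surrogate is nonpositive and the loss is 0. -/
theorem surrogateLoss_le_loss {γ r : ℝ} (hγ : 0 < γ) {b : ℝ × ℝ} (h1 : b.2 ≤ b.1) :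
    surrogateLoss γ r b ≤ loss r b := by
  have key : b.1 < r → r ≤ (1 + γ) * b.1 → 1 / γ * (r - (1 + γ) * b.1) ≤ 0 := fun h2 h3 =>
    mul_nonpos_of_nonneg_of_nonpos (by positivity) (by linarith)
  unfold surrogateLoss loss revenue
  split_ifs <;> grind

theorem measurable_loss : Measurable fun p : ℝ × ℝ × ℝ => loss p.1 p.2 := by
  unfold loss revenue
  refine ((Measurable.ite ?_ ?_ ?_).add (Measurable.ite ?_ ?_ ?_)).neg
  · exact measurableSet_lt measurable_fst (by fun_prop)
  · fun_prop
  · fun_prop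
  · exact (measurableSet_le (by fun_prop) measurable_fst).inter
      (measurableSet_le measurable_fst (by fun_prop))
  · fun_prop
  · fun_prop

theorem measurable_surrogateLoss (γ : ℝ) :
    Measurable fun p : ℝ × ℝ × ℝ => surrogateLoss γ p.1 p.2 := by
  unfold surrogateLoss
  refine ((Measurable.ite ?_ ?_ ?_).neg.sub (Measurable.ite ?_ ?_ ?_)).add
    (Measurable.ite ?_ ?_ ?_)
  · exact measurableSet_le measurable_fst (by fun_prop)
  · fun_prop
  · fun_prop
  · exact (measurableSet_lt (by fun_prop) measurable_fst).inter
      (measurableSet_le measurable_fst (by fun_prop))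
  · fun_prop
  · fun_prop
  · exact (measurableSet_lt (by fun_prop) measurable_fst).inter
      (measurableSet_le measurable_fst (by fun_prop))
  · fun_prop
  · fun_prop

theorem tendsto_mul_nhdsLT_one (r : ℝ) : Tendsto (fun s : ℝ => s * r) (𝓝[<] 1) (𝓝 r) := by
  have : Tendsto (fun s : ℝ => s * r) (𝓝 1) (𝓝 (1 * r)) :=
    (continuous_id.mul continuous_const).tendsto 1
  rw [one_mul] at this
  exact this.mono_left nhdsWithin_le_nhds

/-- Shrinking the reserve price slightly changes the surrogate loss in a controlled way. -/
theorem eventually_surrogateLoss_smul_sub_le {γ M r : ℝ} (hγ : 0 < γ) {b : ℝ × ℝ}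
    (h0 : 0 ≤ b.2) (h1 : b.2 ≤ b.1) (hM : b.1 ≤ M) :
    ∀ᶠ s in 𝓝[<] (1 : ℝ), surrogateLoss γ (s * r) b - surrogateLoss γ r b
      ≤ (1 - s) * ((1 / γ) * (γ * M - (loss r b - surrogateLoss γ r b))) := by
  have hcont : Tendsto (fun s : ℝ => s * r) (𝓝[<] 1) (𝓝 r) :=
      tendsto_mul_nhdsLT_one _
  have hM0 : 0 ≤ M := h0.trans (h1.trans hM)
  have hpos : ∀ᶠ s : ℝ in 𝓝[<] 1, 0 < s ∧ s < 1 :=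
    Ioo_mem_nhdsLT zero_lt_one
  have hRHS : 1 / γ * (γ * M) = M := by field_simp
  by_cases c1 : r ≤ b.2
  · filter_upwards [hpos] with s hs
    have hsr : s * r ≤ b.2 := by
      rcases le_total 0 r with hr | hr
      · nlinarith
      · nlinarith
    have e1 : surrogateLoss γ (s * r) b = surrogateLoss γ r b := by
      unfold surrogateLoss; split_ifs <;> grind
    have e2 : loss r b = surrogateLoss γ r b := by
      unfold loss revenue surrogateLoss; split_ifs <;> grind
    rw [e1, e2, sub_self, sub_zero, hRHS]
    exact mul_nonneg (by linarith) hM0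
  push Not at c1
  by_cases c2 : r ≤ b.1
  · filter_upwards [hpos, hcont.eventually (lt_mem_nhds c1)] with s hs hs2
    have hsr : s * r ≤ b.1 := by nlinarith
    have e1 : surrogateLoss γ (s * r) b = -(s * r) := by
      unfold surrogateLoss; split_ifs <;> grind
    have e2 : loss r b = -r := by
      unfold loss revenue; split_ifs <;> grind
    have e3 : surrogateLoss γ r b = -r := by
      unfold surrogateLoss; split_ifs <;> grind
    rw [e1, e2, e3, sub_self, sub_zero, hRHS]
    nlinarith
  push Not at c2
  -- On the ramp the surrogate falls by (1-s)r/γ, and r exceeds b⁽¹⁾, which bounds the gap between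
  -- the losses.
  by_cases c3 : r ≤ (1 + γ) * b.1
  · filter_upwards [hpos, hcont.eventually (lt_mem_nhds c2)] with s hs hs2
    have hsr : s * r ≤ (1 + γ) * b.1 := by nlinarith
    have e1 : surrogateLoss γ (s * r) b = 1 / γ * (s * r - (1 + γ) * b.1) := by
      unfold surrogateLoss; split_ifs <;> grind
    have e2 : loss r b = 0 := loss_eq_of_lt h1 c2
    have e3 : surrogateLoss γ r b = 1 / γ * (r - (1 + γ) * b.1) := by
      unfold surrogateLoss; split_ifs <;> grind
    have e4 : 1 / γ * (r - (1 + γ) * b.1) = (r - b.1) / γ - b.1 := by field_simp; ring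
    have h5 : 0 ≤ (r - b.1) / γ := div_nonneg (by linarith) hγ.le
    have h6 : 0 ≤ γ * M := by positivity
    rw [e1, e2, e3]
    have e7 : 1 / γ * (s * r - (1 + γ) * b.1) - 1 / γ * (r - (1 + γ) * b.1)
        = (1 - s) * (1 / γ * (-r)) := by ring
    rw [e7]
    refine mul_le_mul_of_nonneg_left (mul_le_mul_of_nonneg_left ?_ (by positivity)) (by linarith)
    rw [e4]
    linarith
  push Not at c3
  · filter_upwards [hpos, hcont.eventually (lt_mem_nhds c2),
      hcont.eventually (lt_mem_nhds c3)] with s hs hs2 hs3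
    have e1 : surrogateLoss γ (s * r) b = 0 := by
      unfold surrogateLoss; split_ifs <;> grind
    have e2 : loss r b = 0 := loss_eq_of_lt h1 c2
    have e3 : surrogateLoss γ r b = 0 := by
      unfold surrogateLoss; split_ifs <;> grind
    rw [e1, e2, e3, sub_self, sub_zero, hRHS]
    exact mul_nonneg (by linarith) hM0

/-- The loss is continuous under shrinking of the reserve price. -/
theorem tendsto_loss_smul {r : ℝ} {b : ℝ × ℝ} (h1 : b.2 ≤ b.1) (h0 : 0 ≤ b.2) :
    Tendsto (fun s : ℝ => loss (s * r) b) (𝓝[<] 1) (𝓝 (loss r b)) := by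
  have hcont : Tendsto (fun s : ℝ => s * r) (𝓝[<] 1) (𝓝 r) :=
      tendsto_mul_nhdsLT_one _
  by_cases hr : r ≤ b.1
  · have hev : ∀ᶠ s : ℝ in 𝓝[<] 1, loss (s * r) b = -max (s * r) b.2 := by
      filter_upwards [Ioo_mem_nhdsLT (zero_lt_one (α := ℝ))] with s hs
      refine loss_eq_of_le ?_
      rcases le_total 0 r with h | h
      · nlinarith [hs.1, hs.2]
      · nlinarith [hs.1, hs.2]
    rw [loss_eq_of_le hr]
    exact (tendsto_congr' hev).2 ((hcont.max tendsto_const_nhds).neg)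
  · push Not at hr
    rw [loss_eq_of_lt h1 hr]
    refine tendsto_const_nhds.congr' ?_
    filter_upwards [hcont.eventually (lt_mem_nhds hr)] with s hs
    exact (loss_eq_of_lt h1 hs).symm

/-- The loss is continuous in the reserve price away from the highest bid. -/
theorem tendsto_loss_of_ne {r : ℝ} {b : ℝ × ℝ} (h1 : b.2 ≤ b.1) (h0 : 0 ≤ b.2)
    (hr : r ≠ b.1 ∨ b.1 = 0) {u : ℕ → ℝ} (hu : Tendsto u atTop (𝓝 r)) :
    Tendsto (fun n => loss (u n) b) atTop (𝓝 (loss r b)) := by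
  rcases hr with hr | hr
  · rcases hr.lt_or_gt with hr | hr
    · rw [loss_eq_of_le hr.le]
      refine ((hu.max tendsto_const_nhds).neg).congr' ?_
      filter_upwards [hu.eventually (gt_mem_nhds hr)] with n hn
      exact (loss_eq_of_le hn.le).symm
    · rw [loss_eq_of_lt h1 hr]
      refine tendsto_const_nhds.congr' ?_
      filter_upwards [hu.eventually (lt_mem_nhds hr)] with n hn
      exact (loss_eq_of_lt h1 hn).symm
  · have hz : ∀ x, loss x b = 0 := fun x =>
      le_antisymm (loss_mem_Icc h0 h1 le_rfl).2 (by simpa [hr] using neg_fst_le_loss (r := x) h0 h1)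
    simp [hz]

end Losses

/-! ### Empirical minimisers, and reduction to a countable subclass. -/

section Auction

variable {X : Type*} {B : Set (ℝ × ℝ)}

/-- An empirical minimiser of the surrogate loss over a convex class containing `0` has empirical
loss exceeding its empirical surrogate loss by at most `γ * M`. -/
theorem empiricalLoss_le_of_isEmpiricalMinimiser (hB : ∀ b ∈ B, 0 ≤ b.2 ∧ b.2 ≤ b.1) {M : ℝ}
    (hM : ∀ b ∈ B, b.1 ≤ M) {H : Set (X → ℝ)} (hH : Convex ℝ H) (h0 : (0 : X → ℝ) ∈ H) {γ : ℝ}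
    (hγ : 0 < γ) {m : ℕ} (hm : 1 ≤ m) {S : Fin m → X × B} {h : X → ℝ}
    (hh : IsEmpiricalMinimiser (surrogateLoss γ) S H h) :
    empiricalLoss loss S h ≤ empiricalLoss (surrogateLoss γ) S h + γ * M := by
  have hmpos : (0 : ℝ) < m := by exact_mod_cast hm
  have hev : ∀ᶠ s in 𝓝[<] (1 : ℝ), ∀ i, surrogateLoss γ (s * h (S i).1) (S i).2
      - surrogateLoss γ (h (S i).1) (S i).2
      ≤ (1 - s) * ((1 / γ) * (γ * M - (loss (h (S i).1) (S i).2
        - surrogateLoss γ (h (S i).1) (S i).2))) :=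
    eventually_all.2 fun i => eventually_surrogateLoss_smul_sub_le hγ
      (hB _ (S i).2.2).1 (hB _ (S i).2.2).2 (hM _ (S i).2.2)
  obtain ⟨s, hs, hs1⟩ := (hev.and (Ioo_mem_nhdsLT (zero_lt_one (α := ℝ)))).exists
  have hsH : s • h ∈ H :=
     (hH.starConvex h0).smul_mem hh.1 hs1.1.le hs1.2.le
  have hmin := hh.2 _ hsH
  unfold empiricalLoss at hmin ⊢
  have hmin' := le_of_mul_le_mul_left hmin (by positivity)
  have hsum := Finset.sum_le_sum fun i (_ : i ∈ (Finset.univ : Finset (Fin m))) => hs i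
  rw [Finset.sum_sub_distrib, ← Finset.mul_sum, ← Finset.mul_sum, Finset.sum_sub_distrib,
    Finset.sum_sub_distrib] at hsum
  simp only [Pi.smul_apply, smul_eq_mul] at hmin'
  -- Minimality against `s • h` makes the total change of the surrogate nonnegative; the positive
  -- factors 1 - s and 1/γ then cancel.
  have h2 : 0 ≤ (1 - s) * ((1 / γ) * ((∑ _i : Fin m, γ * M)
      - (∑ i, loss (h (S i).1) (S i).2 - ∑ i, surrogateLoss γ (h (S i).1) (S i).2))) := by
    linarith
  have h3 := nonneg_of_mul_nonneg_right h2 (by linarith [hs1.2] : 0 < 1 - s)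
  have h4 := nonneg_of_mul_nonneg_right h3 (by positivity : 0 < 1 / γ)
  simp only [Finset.sum_const, Finset.card_univ, Fintype.card_fin, nsmul_eq_mul] at h4
  have h5 : 1 / (m : ℝ) * ∑ i, surrogateLoss γ (h (S i).1) (S i).2 + γ * M
      = 1 / (m : ℝ) * (∑ i, surrogateLoss γ (h (S i).1) (S i).2 + m * (γ * M)) := by
    field_simp
  rw [h5]
  exact mul_le_mul_of_nonneg_left (by linarith) (by positivity)

variable [MeasurableSpace X]

theorem measurable_loss_comp {h : X → ℝ} (hh : Measurable h) :
    Measurable fun z : X × B => loss (h z.1) z.2 :=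
  measurable_loss.comp ((hh.comp measurable_fst).prodMk (measurable_subtype_coe.comp measurable_snd))

theorem measurable_surrogateLoss_comp (γ : ℝ) {h : X → ℝ} (hh : Measurable h) :
    Measurable fun z : X × B => surrogateLoss γ (h z.1) z.2 :=
  (measurable_surrogateLoss γ).comp
    ((hh.comp measurable_fst).prodMk (measurable_subtype_coe.comp measurable_snd))

/-- Uniform deviations over a convex class are detected by a sequentially dense subclass. -/
theorem exists_deviation_gt_of_seq_dense (hB : ∀ b ∈ B, 0 ≤ b.2 ∧ b.2 ≤ b.1) {M : ℝ}
    (hM : ∀ b ∈ B, b.1 ≤ M) (D : Measure (X × B)) [IsProbabilityMeasure D] {H H₀ : Set (X → ℝ)}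
    (hHmeas : ∀ h ∈ H, Measurable h) (hH : Convex ℝ H) (h0 : (0 : X → ℝ) ∈ H) (hH₀ : H₀ ⊆ H)
    (hdense : ∀ h ∈ H, ∃ g : ℕ → X → ℝ, (∀ n, g n ∈ H₀) ∧
      ∀ x, Tendsto (fun n => g n x) atTop (𝓝 (h x)))
    {m : ℕ} (S : Fin m → X × B) {h : X → ℝ} (hh : h ∈ H) {c : ℝ}
    (hc : c < expectedLoss loss D h - empiricalLoss loss S h) :
    ∃ g ∈ H₀, c < expectedLoss loss D g - empiricalLoss loss S g := by
  have habs : ∀ (g : X → ℝ) (z : X × B), |loss (g z.1) z.2| ≤ M := fun g z => by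
    have := loss_mem_Icc (r := g z.1) (hB _ z.2.2).1 (hB _ z.2.2).2 (hM _ z.2.2)
    have h2 : 0 ≤ M := (hB _ z.2.2).1.trans ((hB _ z.2.2).2.trans (hM _ z.2.2))
    exact abs_le.2 ⟨this.1, this.2.trans h2⟩
  have hsH : ∀ s ∈ Set.Ioo (0 : ℝ) 1, s • h ∈ H := fun s hs =>
    (hH.starConvex h0).smul_mem hh hs.1.le hs.2.le
  -- shrink `h` so that no sample value meets a positive highest bid
  obtain ⟨k, hkH, hkc, hkne⟩ : ∃ k ∈ H, c < expectedLoss loss D k - empiricalLoss loss S k ∧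
      ∀ i, k (S i).1 ≠ (S i).2.1.1 ∨ (S i).2.1.1 = 0 := by
    have hE : Tendsto (fun s : ℝ => expectedLoss loss D (s • h)) (𝓝[<] 1)
        (𝓝 (expectedLoss loss D h)) := by
      refine tendsto_integral_filter_of_dominated_convergence (fun _ => M) ?_ ?_
        (integrable_const M) (Eventually.of_forall fun z => ?_)
      · filter_upwards [Ioo_mem_nhdsLT (zero_lt_one (α := ℝ))] with s hs
        exact (measurable_loss_comp (hHmeas _ (hsH s hs))).aestronglyMeasurable
      · exact Eventually.of_forall fun s => Eventually.of_forall fun z => habs _ _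
      · exact tendsto_loss_smul (hB _ z.2.2).2 (hB _ z.2.2).1
    have hS : Tendsto (fun s : ℝ => empiricalLoss loss S (s • h)) (𝓝[<] 1)
        (𝓝 (empiricalLoss loss S h)) :=
      (tendsto_finsetSum _ fun i _ => tendsto_loss_smul (hB _ (S i).2.2).2
        (hB _ (S i).2.2).1).const_mul _
    -- The empirical loss enters with a minus sign, so it must not jump up in the limit: continuity
    -- at every sample point is required. A bid 0 is harmless, its loss being identically 0.
    have hne : ∀ᶠ s : ℝ in 𝓝[<] 1, ∀ i, (s • h) (S i).1 ≠ (S i).2.1.1 ∨ (S i).2.1.1 = 0 := by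
      refine eventually_all.2 fun i => ?_
      by_cases hb : (S i).2.1.1 = 0
      · exact Eventually.of_forall fun s => Or.inr hb
      by_cases hhx : h (S i).1 = (S i).2.1.1
      · filter_upwards [self_mem_nhdsWithin] with s (hs : s < 1)
        left
        simp only [Pi.smul_apply, smul_eq_mul, hhx]
        intro h3
        exact hs.ne (mul_right_cancel₀ hb (h3.trans (one_mul _).symm))
      · have hcont : Tendsto (fun s : ℝ => s * h (S i).1) (𝓝[<] 1) (𝓝 (h (S i).1)) :=
      tendsto_mul_nhdsLT_one _
        filter_upwards [hcont.eventually_ne hhx] with s hs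
        exact Or.inl hs
    obtain ⟨s, ⟨hs1, hs2⟩, hs3⟩ := (((hE.sub hS).eventually (lt_mem_nhds hc)).and hne |>.and
      (Ioo_mem_nhdsLT (zero_lt_one (α := ℝ)))).exists
    exact ⟨s • h, hsH s hs3, hs1, hs2⟩
  obtain ⟨g, hgH₀, hg⟩ := hdense k hkH
  have hS : Tendsto (fun n => empiricalLoss loss S (g n)) atTop (𝓝 (empiricalLoss loss S k)) :=
    (tendsto_finsetSum _ fun i _ => tendsto_loss_of_ne (hB _ (S i).2.2).2 (hB _ (S i).2.2).1
      (hkne i) (hg _)).const_mul _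
  obtain ⟨c', hc', hc'2⟩ := exists_between hkc
  have hS' : ∀ᶠ n in atTop, empiricalLoss loss S (g n) < empiricalLoss loss S k + (c' - c) :=
    hS.eventually (gt_mem_nhds (by linarith))
  have hint : ∀ g' ∈ H, Integrable (fun z : X × B => loss (g' z.1) z.2) D := fun g' hg' =>
    integrable_of_measurable_of_abs_le (measurable_loss_comp (hHmeas _ hg')) (habs g')
  -- Adding M makes the loss nonnegative, as Fatou's lemma needs.
  have hlint : ∀ g' ∈ H, ∫⁻ z, ENNReal.ofReal (loss (g' z.1) z.2 + M) ∂D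
      = ENNReal.ofReal (expectedLoss loss D g' + M) := fun g' hg' => by
    have hadd : Integrable (fun z : X × B => loss (g' z.1) z.2 + M) D :=
      (hint g' hg').add (integrable_const M)
    rw [← ofReal_integral_eq_lintegral_ofReal hadd
      (Eventually.of_forall fun z => by
        simpa using by linarith [(abs_le.1 (habs g' z)).1]),
      integral_add (hint g' hg') (integrable_const M)]
    simp [expectedLoss]
  -- lower semicontinuity of the loss and Fatou's lemma
  have hfatou : ENNReal.ofReal (expectedLoss loss D k + M)
      ≤ liminf (fun n => ENNReal.ofReal (expectedLoss loss D (g n) + M)) atTop := by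
    rw [← hlint k hkH]
    simp_rw [← fun n => hlint (g n) (hH₀ (hgH₀ n))]
    refine le_trans (lintegral_mono fun z => ?_) (lintegral_liminf_le fun n =>
      ((measurable_loss_comp (hHmeas _ (hH₀ (hgH₀ n)))).add_const M).ennreal_ofReal)
    -- At the discontinuity the loss takes its minimum -b⁽¹⁾, so it is lower semicontinuous. D may
    -- charge this set, so pointwise convergence is not available there.
    by_cases hz : k z.1 = z.2.1.1
    · refine le_liminf_of_le (by isBoundedDefault) (Eventually.of_forall fun n => ?_)
      refine ENNReal.ofReal_le_ofReal ?_
      have e : loss (k z.1) z.2 = -z.2.1.1 := by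
        rw [loss_eq_of_le hz.le, hz, max_eq_left (hB _ z.2.2).2]
      have := neg_fst_le_loss (r := g n z.1) (hB _ z.2.2).1 (hB _ z.2.2).2
      rw [e]
      linarith
    · exact (ENNReal.tendsto_ofReal ((tendsto_loss_of_ne (hB _ z.2.2).2 (hB _ z.2.2).1
        (Or.inl hz) (hg _)).add_const M)).liminf_eq.ge
  have hE' : ∀ᶠ n in atTop, expectedLoss loss D k - (expectedLoss loss D k
      - empiricalLoss loss S k - c') < expectedLoss loss D (g n) := by
    -- `ENNReal.ofReal` truncates negative numbers; a threshold below -M holds trivially.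
    by_cases hneg : expectedLoss loss D k - (expectedLoss loss D k
      - empiricalLoss loss S k - c') + M < 0
    · refine Eventually.of_forall fun n => ?_
      have h1 : |expectedLoss loss D (g n)| ≤ M :=
        abs_integral_le_integral_abs.trans ((integral_mono (hint _ (hH₀ (hgH₀ n))).abs
          (integrable_const M) fun z => habs _ z).trans (by simp))
      linarith [(abs_le.1 h1).1]
    · push Not at hneg
      have hlt := (ENNReal.ofReal_lt_ofReal_iff_of_nonneg hneg).2
        (by linarith : _ < expectedLoss loss D k + M)
      filter_upwards [eventually_lt_of_lt_liminf (hlt.trans_le hfatou)] with n hn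
      have := (ENNReal.ofReal_lt_ofReal_iff_of_nonneg hneg).1 hn
      linarith
  obtain ⟨n, hn1, hn2⟩ := (hS'.and hE').exists
  exact ⟨g n, hgH₀ n, by linarith⟩

end Auction

/-! ### Deviation bounds at confidence δ/2. -/

section Concentration

variable {ι Z : Type*} {m : ℕ}

theorem normalised_sum_sub_update_le {f : Z → ℝ} {M : ℝ}
    (hf : ∀ z z', f z - f z' ≤ M) (S : Fin m → Z) (i : Fin m) (z : Z) :
    (1 / (m : ℝ)) * ∑ j, f (S j) - (1 / (m : ℝ)) * ∑ j, f (Function.update S i z j) ≤ M / m := by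
  classical
  rw [← mul_sub, ← Finset.sum_sub_distrib, Finset.sum_eq_single i]
  · rw [Function.update_self, one_div, inv_mul_eq_div]
    gcongr
    exact hf _ _
  · intro j _ hj
    rw [Function.update_of_ne hj, sub_self]
  · simp

/-- Calibrates the deviation so that McDiarmid's tail with oscillation M/m equals δ/2. -/
theorem exp_neg_two_mul_sq_div_eq (hm : 1 ≤ m) {M δ : ℝ} (hM : 0 < M) (hδ : 0 < δ) (hδ2 : δ ≤ 2) :
    Real.exp (-(2 * (M * √(Real.log (2 / δ) / (2 * m))) ^ 2 / (m * (M / m) ^ 2))) = δ / 2 := by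
  have hmpos : (0 : ℝ) < m := by exact_mod_cast hm
  have hlog : 0 ≤ Real.log (2 / δ) := Real.log_nonneg (by rwa [le_div_iff₀ hδ, one_mul])
  rw [mul_pow, Real.sq_sqrt (by positivity)]
  have : 2 * (M ^ 2 * (Real.log (2 / δ) / (2 * m))) / (m * (M / m) ^ 2) = Real.log (2 / δ) := by
    field_simp
  rw [this, ← Real.log_inv, Real.exp_log (by positivity), inv_div]

variable [MeasurableSpace Z]

/-- Hoeffding's inequality for an empirical mean, in terms of the confidence. -/
theorem measure_normalised_sum_gt_le (hm : 1 ≤ m) (μ : Measure Z) [IsProbabilityMeasure μ]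
    {f : Z → ℝ} (hf : Measurable f) {M δ : ℝ} (hM : 0 < M) (hfM : ∀ z, f z ∈ Set.Icc (-M) 0)
    (hδ : 0 < δ) (hδ2 : δ ≤ 2) :
    (Measure.pi fun _ : Fin m => μ) {S | ∫ z, f z ∂μ + M * √(Real.log (2 / δ) / (2 * m))
        < (1 / (m : ℝ)) * ∑ j, f (S j)} ≤ ENNReal.ofReal (δ / 2) := by
  have hmpos : (0 : ℝ) < m := by exact_mod_cast hm
  have habs : ∀ z, |f z| ≤ M := fun z => abs_le.2 ⟨(hfM z).1, (hfM z).2.trans hM.le⟩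
  have h := measure_lt_of_bounded_differences μ (c := M / m) (by positivity) hm
    (f := fun S => (1 / (m : ℝ)) * ∑ j, f (S j))
    ((Finset.measurable_sum _ fun j _ => hf.comp (measurable_pi_apply j)).const_mul _)
    (fun S => abs_normalised_sum_le hm fun j => habs (S j))
    (normalised_sum_sub_update_le fun z z' => by linarith [(hfM z).2, (hfM z').1])
    (s := M * √(Real.log (2 / δ) / (2 * m))) (by positivity)
  rwa [integral_normalised_sum hm μ hf habs, exp_neg_two_mul_sq_div_eq hm hM hδ hδ2] at h

/-- Uniform deviation bound for a countable family of bounded functions. -/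
theorem measure_uniform_deviation_gt_le [Countable ι] [Nonempty ι] (hm : 1 ≤ m) (μ : Measure Z)
    [IsProbabilityMeasure μ] {l : ι → Z → ℝ} (hl : ∀ i, Measurable (l i)) {M δ : ℝ} (hM : 0 < M)
    (hlM : ∀ i z, l i z ∈ Set.Icc (-M) 0) (hδ : 0 < δ) (hδ2 : δ ≤ 2) :
    (Measure.pi fun _ : Fin m => μ)
      {S | ∃ i, 2 * ∫ S, averageSignedSup l S ∂(Measure.pi fun _ : Fin m => μ)
        + M * √(Real.log (2 / δ) / (2 * m))
        < (∫ z, l i z ∂μ) - (1 / (m : ℝ)) * ∑ j, l i (S j)} ≤ ENNReal.ofReal (δ / 2) := by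
  have hmpos : (0 : ℝ) < m := by exact_mod_cast hm
  have habs : ∀ i z, |l i z| ≤ M := fun i z =>
    abs_le.2 ⟨(hlM i z).1, (hlM i z).2.trans hM.le⟩
  have hmul : ∀ i, |∫ z, l i z ∂μ| ≤ M := fun i =>
    abs_integral_le_integral_abs.trans ((integral_mono
      (integrable_of_measurable_of_abs_le (hl i) (habs i)).abs (integrable_const M)
      fun z => habs i z).trans (by simp))
  have hdev : ∀ (S : Fin m → Z) i,
      |(∫ z, l i z ∂μ) - (1 / (m : ℝ)) * ∑ j, l i (S j)| ≤ M + M := fun S i =>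
    (abs_sub _ _).trans (add_le_add (hmul i) (abs_normalised_sum_le hm fun j => habs i (S j)))
  have hbdd := fun S => bddAbove_range_of_abs_le (hdev S)
  have h := measure_lt_of_bounded_differences μ (c := M / m) (by positivity) hm
    (f := fun S => ⨆ i, ((∫ z, l i z ∂μ) - (1 / (m : ℝ)) * ∑ j, l i (S j)))
    (Measurable.iSup fun i => measurable_const.sub
      ((Finset.measurable_sum _ fun j _ => (hl i).comp (measurable_pi_apply j)).const_mul _))
    (fun S => abs_ciSup_le_of_abs_le (hdev S)) (fun S i z => by
      rw [sub_le_iff_le_add]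
      refine ciSup_le fun k => ?_
      have h1 := le_ciSup (hbdd (Function.update S i z)) k
      have h2 := normalised_sum_sub_update_le (f := fun z => -l k z) (M := M)
        (fun z z' => by linarith [(hlM k z).1, (hlM k z').2]) S i z
      simp only [Finset.sum_neg_distrib, mul_neg] at h2
      linarith)
    (s := M * √(Real.log (2 / δ) / (2 * m))) (by positivity)
  rw [exp_neg_two_mul_sq_div_eq hm hM hδ hδ2] at h
  refine (measure_mono fun S hS => ?_).trans h
  obtain ⟨i, hi⟩ := hS
  have h1 := le_ciSup (hbdd S) i
  have h2 := integral_deviation_le hm μ hl habs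
  simp only [Set.mem_ofPred_eq]
  linarith

end Concentration

/-! ### Extended-valued Rademacher complexity. -/

section Rademacher

variable {Z : Type*} {m : ℕ}

/-- Membership of 0 makes every supremum nonnegative, so a finite average forces each of them to be
finite. -/
theorem exists_of_empiricalRademacher_ne_top {G : Set (Z → ℝ)} (h0 : (0 : Z → ℝ) ∈ G)
    {z : Fin m → Z} (hG : empiricalRademacher G z ≠ ⊤) :
    ∃ r : (Fin m → ℤˣ) → ℝ,
      (∀ σ, ∀ g ∈ G, (1 / (m : ℝ)) * ∑ j, signVec σ j * g (z j) ≤ r σ) ∧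
      empiricalRademacher G z = (((2 : ℝ) ^ m)⁻¹ * ∑ σ, r σ : ℝ) := by
  set a : (Fin m → ℤˣ) → EReal := fun σ =>
    ⨆ g ∈ G, (((1 / (m : ℝ)) * ∑ i, ((σ i : ℤ) : ℝ) * g (z i) : ℝ) : EReal) with ha
  have hle : ∀ σ, ∀ g ∈ G, (((1 / (m : ℝ)) * ∑ j, signVec σ j * g (z j) : ℝ) : EReal) ≤ a σ :=
    fun σ g hg => le_iSup₂_of_le
      (f := fun (g : Z → ℝ) (_ : g ∈ G) =>
        (((1 / (m : ℝ)) * ∑ i, ((σ i : ℤ) : ℝ) * g (z i) : ℝ) : EReal)) g hg le_rfl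
  have hnonneg : ∀ σ, 0 ≤ a σ := fun σ => by simpa using hle σ 0 h0
  have hpow : (0 : ℝ) < ((2 : ℝ) ^ m)⁻¹ := by positivity
  have hfin : ∀ σ, a σ ≠ ⊤ := fun σ hσ => hG <| by
    have h1 : ∑ σ, a σ = ⊤ := top_le_iff.1 (hσ ▸ Finset.single_le_sum
      (f := a) (fun σ _ => hnonneg σ) (Finset.mem_univ σ))
    unfold empiricalRademacher
    rw [h1]
    exact EReal.coe_mul_top_of_pos hpow
  have hcoe : ∀ σ, ((a σ).toReal : EReal) = a σ := fun σ =>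
    EReal.coe_toReal (hfin σ) (ne_bot_of_le_ne_bot EReal.zero_ne_bot (hnonneg σ))
  refine ⟨fun σ => (a σ).toReal, fun σ g hg => ?_, ?_⟩
  · rw [← EReal.coe_le_coe_iff, hcoe]
    exact hle σ g hg
  · have h2 : ∀ s : Finset (Fin m → ℤˣ), ∀ f : (Fin m → ℤˣ) → ℝ,
        ((∑ σ ∈ s, f σ : ℝ) : EReal) = ∑ σ ∈ s, (f σ : EReal) := fun s f => by
      classical
      induction s using Finset.induction_on with
      | empty => simp
      | insert b s hb ih => rw [Finset.sum_insert hb, Finset.sum_insert hb, EReal.coe_add, ih]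
    rw [EReal.coe_mul, h2]
    simp_rw [hcoe]
    rfl

theorem measurable_empiricalRademacher [MeasurableSpace Z] {G : Set (Z → ℝ)} (hG : G.Countable)
    (hmeas : ∀ g ∈ G, Measurable g) :
    Measurable fun z : Fin m → Z => empiricalRademacher G z := by
  unfold empiricalRademacher
  refine (Finset.measurable_sum _ fun σ _ => ?_).const_mul _
  refine Measurable.biSup _ hG fun g hg => ?_
  refine Measurable.coe_real_ereal ?_
  exact (Finset.measurable_sum _ fun j _ =>
    ((hmeas g hg).comp (measurable_pi_apply j)).const_mul _).const_mul _

theorem rademacher_mono [MeasurableSpace Z] {G G' : Set (Z → ℝ)} (h : G ⊆ G') (μ : Measure Z) :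
    rademacher G μ m ≤ rademacher G' μ m := by
  refine lintegral_mono fun z => EReal.toENNReal_le_toENNReal ?_
  unfold empiricalRademacher
  refine mul_le_mul_of_nonneg_left ?_
    (by exact_mod_cast (by positivity : (0 : ℝ) ≤ ((2 : ℝ) ^ m)⁻¹))
  exact Finset.sum_le_sum fun σ _ => biSup_mono fun g hg => h hg

end Rademacher

/-! ### Rademacher average of the true loss. -/

section LossComplexity

variable {X : Type*} {B : Set (ℝ × ℝ)} {m : ℕ}

theorem mul_log_nonneg {d m : ℕ} (hdm : d ≤ m) :
    0 ≤ (d : ℝ) * Real.log (Real.exp 1 * m / d) := by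
  rcases Nat.eq_zero_or_pos d with rfl | hd
  · simp
  have hd' : (0 : ℝ) < d := by exact_mod_cast hd
  refine mul_nonneg hd'.le (Real.log_nonneg ?_)
  rw [le_div_iff₀ hd', one_mul]
  have h1 : (d : ℝ) ≤ m := by exact_mod_cast hdm
  have h2 : (1 : ℝ) ≤ Real.exp 1 := Real.one_le_exp zero_le_one
  nlinarith

/-- Complexity of the jump part of the loss, by Sauer–Shelah and Massart. -/
theorem average_ciSup_jump_le (hB : ∀ b ∈ B, 0 ≤ b.2 ∧ b.2 ≤ b.1) {M : ℝ} (hM0 : 0 < M)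
    (hM : ∀ b ∈ B, b.1 ≤ M) {H H₀ : Set (X → ℝ)} [Nonempty H₀] (hH₀ : H₀ ⊆ H) {d : ℕ}
    (hd : pseudoDim H ≤ d) (hm : 1 ≤ m) (hdm : d ≤ m) (S : Fin m → X × B) :
    ((2 : ℝ) ^ m)⁻¹ * ∑ σ : Fin m → ℤˣ, ⨆ h : H₀, ∑ j, signVec σ j *
        (if (S j).2.1.1 < h.1 (S j).1 then (S j).2.1.1 else 0)
      ≤ M * √m * √(2 * (d * Real.log (Real.exp 1 * m / d))) := by
  classical
  let 𝒜 := Finset.univ.filter fun u : Finset (Fin m) =>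
    ∃ h ∈ H, u = Finset.univ.filter fun j => (S j).2.1.1 < h (S j).1
  let φ : Finset (Fin m) → Fin m → ℝ := fun u j => if j ∈ u then (S j).2.1.1 else 0
  have hcard : (𝒜.card : ℝ) ≤ Real.exp (d * Real.log (Real.exp 1 * m / d)) := by
    convert card_threshold_traces_le hd hdm (fun j => (S j).1) (fun j => (S j).2.1.1)
  refine average_ciSup_le_of_finite (V := 𝒜.image φ) (fun h => ?_)
    ((Nat.cast_le.2 Finset.card_image_le).trans hcard) (mul_log_nonneg hdm) hM0 hm fun v hv j => ?_
  · refine Finset.mem_image.2 ⟨Finset.univ.filter fun j => (S j).2.1.1 < h.1 (S j).1, ?_, ?_⟩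
    · exact Finset.mem_filter.2 ⟨Finset.mem_univ _, h.1, hH₀ h.2, rfl⟩
    · ext j; simp [φ]
  · obtain ⟨u, -, rfl⟩ := Finset.mem_image.1 hv
    have h1 := hB _ (S j).2.2
    have h2 := hM _ (S j).2.2
    simp only [φ]
    split_ifs
    · rw [abs_of_nonneg (h1.1.trans h1.2)]; exact h2
    · simpa using hM0.le

/-- The Rademacher average of the losses is controlled by that of the hypotheses and a capacity
term for the jump of the loss. -/
theorem ofReal_averageSignedSup_loss_le (hB : ∀ b ∈ B, 0 ≤ b.2 ∧ b.2 ≤ b.1) {M : ℝ} (hM0 : 0 < M)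
    (hM : ∀ b ∈ B, b.1 ≤ M) {H H₀ : Set (X → ℝ)} (hH₀ : H₀ ⊆ H) (h0 : (0 : X → ℝ) ∈ H₀) {d : ℕ}
    (hd : pseudoDim H ≤ d) (hm : 1 ≤ m) (hdm : d ≤ m) (S : Fin m → X × B) :
    ENNReal.ofReal (averageSignedSup (fun (h : H₀) (z : X × B) => loss (h.1 z.1) z.2) S)
      ≤ (empiricalRademacher H₀ fun j => (S j).1).toENNReal
        + ENNReal.ofReal (M * √(2 * d * Real.log (Real.exp 1 * m / d) / m)) := by
  have hne : Nonempty H₀ := ⟨⟨0, h0⟩⟩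
  have hmpos : (0 : ℝ) < m := by exact_mod_cast hm
  by_cases htop : empiricalRademacher H₀ (fun j => (S j).1) = ⊤
  · simp [htop]
  obtain ⟨r, hr, hreq⟩ := exists_of_empiricalRademacher_ne_top h0 htop
  let u : H₀ → Fin m → ℝ := fun h j => h.1 (S j).1
  -- The loss is `w + v`: a 1-Lipschitz clip of the hypothesis plus the jump at the highest bid.
  let w : H₀ → Fin m → ℝ := fun h j => -max (min (h.1 (S j).1) (S j).2.1.1) (S j).2.1.2
  let v : H₀ → Fin m → ℝ := fun h j =>
    if (S j).2.1.1 < h.1 (S j).1 then (S j).2.1.1 else 0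
  have hr' : ∀ (h : H₀) σ, ∑ j, signVec σ j * u h j ≤ m * r σ := fun h σ => by
    have := hr σ h.1 h.2
    rwa [one_div, inv_mul_le_iff₀ hmpos] at this
  have hu : ∀ h j, |u h j| ≤ m * ∑ σ, |r σ| := fun h j =>
    abs_le_of_signed_sums_le (fun σ => (hr' h σ).trans (mul_le_mul_of_nonneg_left
      ((le_abs_self _).trans (Finset.single_le_sum (f := fun σ => |r σ|)
        (fun _ _ => abs_nonneg _) (Finset.mem_univ σ))) hmpos.le)) j
  have hw : ∀ h j, |w h j| ≤ M := fun h j => by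
    have h1 := hB _ (S j).2.2
    have h2 := hM _ (S j).2.2
    simp only [w]
    rw [abs_neg, abs_of_nonneg (h1.1.trans (le_max_right _ _))]
    exact max_le ((min_le_right _ _).trans h2) (h1.2.trans h2)
  have hv : ∀ h j, |v h j| ≤ M := fun h j => by
    have h1 := hB _ (S j).2.2
    have h2 := hM _ (S j).2.2
    simp only [v]
    split_ifs
    · rw [abs_of_nonneg (h1.1.trans h1.2)]; exact h2
    · simpa using hM0.le
  set K : ℝ := m * ∑ σ, |r σ| + M
  have hK0 : (0 : ℝ) ≤ m * ∑ σ, |r σ| := by positivity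
  have hcontr := sum_ciSup_le_of_contraction (K := K) (u := u) (w := w)
    (fun h j => (hu h j).trans (by simp only [K]; linarith))
    (fun h j => (hw h j).trans (by simp only [K]; linarith))
    (fun h k j => abs_clip_sub_clip_le _ _ _ _)
  have hur : ∑ σ : Fin m → ℤˣ, (⨆ h, ∑ j, signVec σ j * u h j) ≤ m * ∑ σ, r σ := by
    rw [Finset.mul_sum]
    exact Finset.sum_le_sum fun σ _ => ciSup_le fun h => hr' h σ
  have hjump : ((2 : ℝ) ^ m)⁻¹ * ∑ σ : Fin m → ℤˣ, ⨆ h, ∑ j, signVec σ j * v h j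
      ≤ M * √m * √(2 * (d * Real.log (Real.exp 1 * m / d))) :=
    average_ciSup_jump_le hB hM0 hM hH₀ hd hm hdm S
  have hsplit : ∀ σ : Fin m → ℤˣ,
      signedSup (fun (h : H₀) (z : X × B) => loss (h.1 z.1) z.2) (signVec σ) S
        ≤ (1 / (m : ℝ)) * ((⨆ h, ∑ j, signVec σ j * w h j)
          + ⨆ h, ∑ j, signVec σ j * v h j) := fun σ => by
    refine ciSup_le fun h => mul_le_mul_of_nonneg_left ?_ (by positivity)
    have e1 := le_ciSup (bddAbove_range_of_abs_le fun h => abs_signed_sum_le_sum (hw h) σ) h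
    have e2 := le_ciSup (bddAbove_range_of_abs_le fun h => abs_signed_sum_le_sum (hv h) σ) h
    refine le_of_eq_of_le ?_ (add_le_add e1 e2)
    rw [← Finset.sum_add_distrib]
    refine Finset.sum_congr rfl fun j _ => ?_
    have := loss_sub_indicator (r := h.1 (S j).1) (hB _ (S j).2.2).2
    rw [← mul_add]
    congr 1
    simp only [w, v]
    linarith
  have hsqrt : (1 / (m : ℝ)) * (M * √m * √(2 * (d * Real.log (Real.exp 1 * m / d))))
      = M * √(2 * d * Real.log (Real.exp 1 * m / d) / m) := by
    rw [← mul_assoc 2, Real.sqrt_div (by rw [mul_assoc]; linarith [mul_log_nonneg hdm])]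
    have hs : √(m : ℝ) * √m = m := Real.mul_self_sqrt hmpos.le
    have hs0 : √(m : ℝ) ≠ 0 := (Real.sqrt_pos.2 hmpos).ne'
    generalize √(2 * d * Real.log (Real.exp 1 * m / d)) = q
    field_simp
    linear_combination q * hs
  have hmain : averageSignedSup (fun (h : H₀) (z : X × B) => loss (h.1 z.1) z.2) S
      ≤ ((2 : ℝ) ^ m)⁻¹ * ∑ σ, r σ + M * √(2 * d * Real.log (Real.exp 1 * m / d) / m) := by
    calc averageSignedSup (fun (h : H₀) (z : X × B) => loss (h.1 z.1) z.2) S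
        ≤ ((2 : ℝ) ^ m)⁻¹ * ∑ σ : Fin m → ℤˣ, (1 / (m : ℝ)) *
          ((⨆ h, ∑ j, signVec σ j * w h j) + ⨆ h, ∑ j, signVec σ j * v h j) :=
          mul_le_mul_of_nonneg_left (Finset.sum_le_sum fun σ _ => hsplit σ) (by positivity)
      _ = ((2 : ℝ) ^ m)⁻¹ * ((1 / (m : ℝ)) * ∑ σ : Fin m → ℤˣ, ⨆ h, ∑ j, signVec σ j * w h j)
          + (1 / (m : ℝ)) * (((2 : ℝ) ^ m)⁻¹ *
            ∑ σ : Fin m → ℤˣ, ⨆ h, ∑ j, signVec σ j * v h j) := by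
          rw [← Finset.mul_sum, Finset.sum_add_distrib]; ring
      _ ≤ ((2 : ℝ) ^ m)⁻¹ * ((1 / (m : ℝ)) * (m * ∑ σ, r σ))
          + (1 / (m : ℝ)) * (M * √m * √(2 * (d * Real.log (Real.exp 1 * m / d)))) := by
          gcongr
          exact hcontr.trans hur
      _ = _ := by rw [hsqrt]; congr 2; field_simp
  rw [hreq, EReal.toENNReal_of_ne_top (EReal.coe_ne_top _), EReal.toReal_coe]
  exact (ENNReal.ofReal_le_ofReal hmain).trans ENNReal.ofReal_add_le

variable [MeasurableSpace X]

theorem integral_le_toReal_lintegral_ofReal {Ω : Type*} [MeasurableSpace Ω] {μ : Measure Ω}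
    {f : Ω → ℝ} (hf : Integrable f μ) : ∫ x, f x ∂μ ≤ (∫⁻ x, ENNReal.ofReal (f x) ∂μ).toReal := by
  rw [integral_eq_lintegral_pos_part_sub_lintegral_neg_part hf]
  exact sub_le_self _ ENNReal.toReal_nonneg

theorem integral_averageSignedSup_loss_le (hB : ∀ b ∈ B, 0 ≤ b.2 ∧ b.2 ≤ b.1) {M : ℝ}
    (hM0 : 0 < M) (hM : ∀ b ∈ B, b.1 ≤ M) (D : Measure (X × B)) [IsProbabilityMeasure D]
    {H H₀ : Set (X → ℝ)} (hH₀ : H₀ ⊆ H) (hcount : H₀.Countable) (hmeas : ∀ h ∈ H₀, Measurable h)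
    (h0 : (0 : X → ℝ) ∈ H₀) {d : ℕ} (hd : pseudoDim H ≤ d) (hm : 1 ≤ m) (hdm : d ≤ m)
    (hfin : rademacher H₀ D.fst m ≠ ⊤) :
    ∫ S, averageSignedSup (fun (h : H₀) (z : X × B) => loss (h.1 z.1) z.2) S
        ∂(Measure.pi fun _ : Fin m => D)
      ≤ (rademacher H₀ D.fst m).toReal
        + M * √(2 * d * Real.log (Real.exp 1 * m / d) / m) := by
  have hne : Nonempty H₀ := ⟨⟨0, h0⟩⟩
  have : Countable H₀ := hcount.to_subtype
  have hl : ∀ h : H₀, Measurable fun z : X × B => loss (h.1 z.1) z.2 := fun h =>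
    measurable_loss_comp (hmeas _ h.2)
  have habs : ∀ (h : H₀) (z : X × B), |loss (h.1 z.1) z.2| ≤ M := fun h z => by
    have := loss_mem_Icc (r := h.1 z.1) (hB _ z.2.2).1 (hB _ z.2.2).2 (hM _ z.2.2)
    exact abs_le.2 ⟨this.1, this.2.trans hM0.le⟩
  have hint : Integrable (fun S => averageSignedSup
      (fun (h : H₀) (z : X × B) => loss (h.1 z.1) z.2) S) (Measure.pi fun _ : Fin m => D) := by
    unfold averageSignedSup
    refine (integrable_finsetSum _ fun σ _ => ?_).const_mul _
    exact integrable_of_measurable_of_abs_le (measurable_signedSup hl _) fun S =>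
      abs_ciSup_le_of_abs_le fun i => abs_signed_sum_le hm habs (abs_signVec σ) S i
  have hmp : MeasurePreserving (fun (S : Fin m → X × B) j => (S j).1)
      (Measure.pi fun _ : Fin m => D) (Measure.pi fun _ : Fin m => D.fst) :=
    measurePreserving_pi _ _ fun _ => ⟨measurable_fst, rfl⟩
  have hrad : ∫⁻ S, (empiricalRademacher H₀ fun j => (S j).1).toENNReal
      ∂(Measure.pi fun _ : Fin m => D) = rademacher H₀ D.fst m :=
    hmp.lintegral_comp (measurable_empiricalRademacher hcount hmeas).ereal_toENNReal
  set C := M * √(2 * d * Real.log (Real.exp 1 * m / d) / m)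
  have hC : 0 ≤ C := by positivity
  refine (integral_le_toReal_lintegral_ofReal hint).trans ?_
  have h1 : ∫⁻ S, ENNReal.ofReal (averageSignedSup
      (fun (h : H₀) (z : X × B) => loss (h.1 z.1) z.2) S) ∂(Measure.pi fun _ : Fin m => D)
      ≤ rademacher H₀ D.fst m + ENNReal.ofReal C := by
    refine (lintegral_mono fun S =>
      ofReal_averageSignedSup_loss_le hB hM0 hM hH₀ h0 hd hm hdm S).trans (le_of_eq ?_)
    rw [lintegral_add_right _ measurable_const, hrad]
    simp [C]
  refine (ENNReal.toReal_mono (by simp [hfin]) h1).trans (le_of_eq ?_)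
  rw [ENNReal.toReal_add hfin ENNReal.ofReal_ne_top, ENNReal.toReal_ofReal hC]

end LossComplexity

/-! ### Uniform generalisation bound and the union of the two bad events. -/

section Generalisation

variable {X : Type*} [MeasurableSpace X] {B : Set (ℝ × ℝ)} {m : ℕ}

/-- Uniform one-sided generalisation bound for the true loss over a convex class. -/
theorem measure_exists_loss_deviation_gt_le (hB : ∀ b ∈ B, 0 ≤ b.2 ∧ b.2 ≤ b.1) {M : ℝ}
    (hM0 : 0 < M) (hM : ∀ b ∈ B, b.1 ≤ M) (D : Measure (X × B)) [IsProbabilityMeasure D]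
    {H : Set (X → ℝ)} (hHmeas : ∀ h ∈ H, Measurable h) (hH : Convex ℝ H)
    (h0 : (0 : X → ℝ) ∈ H) {d : ℕ} (hd : pseudoDim H ≤ d) (hm : 1 ≤ m) (hdm : d ≤ m) {δ : ℝ}
    (hδ : 0 < δ) (hδ2 : δ ≤ 2) (hfin : rademacher H D.fst m ≠ ⊤) :
    (Measure.pi fun _ : Fin m => D)
      {S | ∃ h ∈ H, 2 * ((rademacher H D.fst m).toReal
          + M * √(2 * d * Real.log (Real.exp 1 * m / d) / m))
          + M * √(Real.log (2 / δ) / (2 * m))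
        < expectedLoss loss D h - empiricalLoss loss S h} ≤ ENNReal.ofReal (δ / 2) := by
  obtain ⟨H₁, hH₁, hcount, hdense⟩ := exists_countable_seq_dense hd hH h0
  -- Adjoining 0 keeps the subclass countable and makes its suprema nonnegative.
  set H₀ := insert (0 : X → ℝ) H₁
  have hH₀ : H₀ ⊆ H := Set.insert_subset h0 hH₁
  have h00 : (0 : X → ℝ) ∈ H₀ := Set.mem_insert _ _
  have hcount₀ : H₀.Countable := hcount.insert 0
  have hne : Nonempty H₀ := ⟨⟨0, h00⟩⟩
  have : Countable H₀ := hcount₀.to_subtype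
  have hmono := rademacher_mono (m := m) hH₀ D.fst
  have hbound := integral_averageSignedSup_loss_le hB hM0 hM D hH₀ hcount₀
    (fun h hh => hHmeas h (hH₀ hh)) h00 hd hm hdm (ne_top_of_le_ne_top hfin hmono)
  have hR := ENNReal.toReal_mono hfin hmono
  refine (measure_mono fun S hS => ?_).trans (measure_uniform_deviation_gt_le hm D
    (l := fun (h : H₀) (z : X × B) => loss (h.1 z.1) z.2)
    (fun h => measurable_loss_comp (hHmeas _ (hH₀ h.2))) hM0
    (fun h z => loss_mem_Icc (hB _ z.2.2).1 (hB _ z.2.2).2 (hM _ z.2.2)) hδ hδ2)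
  obtain ⟨h, hh, hlt⟩ := hS
  obtain ⟨g, hg, hgt⟩ := exists_deviation_gt_of_seq_dense hB hM D hHmeas hH h0 hH₀
    (fun k hk => by
      obtain ⟨g, hg, hgk⟩ := hdense k hk
      exact ⟨g, fun n => Set.mem_insert_of_mem _ (hg n), hgk⟩) S hh hlt
  refine ⟨⟨g, hg⟩, lt_of_le_of_lt ?_ hgt⟩
  linarith

/-- Along a fixed sequence of hypotheses, the empirical surrogate losses eventually all exceed
their expectations only on a small set of samples. -/
theorem measure_eventually_surrogateLoss_gt_le (hB : ∀ b ∈ B, 0 ≤ b.2 ∧ b.2 ≤ b.1) {M : ℝ}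
    (hM0 : 0 < M) (hM : ∀ b ∈ B, b.1 ≤ M) (D : Measure (X × B)) [IsProbabilityMeasure D]
    {γ : ℝ} (hγ : 0 < γ) (hm : 1 ≤ m) {δ : ℝ} (hδ : 0 < δ) (hδ2 : δ ≤ 2) {g : ℕ → X → ℝ}
    (hg : ∀ n, Measurable (g n)) :
    (Measure.pi fun _ : Fin m => D)
      {S | ∃ N, ∀ n ≥ N, expectedLoss (surrogateLoss γ) D (g n)
          + M * √(Real.log (2 / δ) / (2 * m)) < empiricalLoss (surrogateLoss γ) S (g n)}
      ≤ ENNReal.ofReal (δ / 2) := by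
  set A : ℕ → Set (Fin m → X × B) := fun N =>
    {S | ∀ n ≥ N, expectedLoss (surrogateLoss γ) D (g n)
      + M * √(Real.log (2 / δ) / (2 * m)) < empiricalLoss (surrogateLoss γ) S (g n)} with hA
  -- The infimum 𝓛* need not be attained. Continuity from below along an increasing union treats the
  -- whole minimising sequence at the price of one Hoeffding bound.
  have hmono : Monotone A := fun N N' hNN' S hS n hn => hS n (hNN'.trans hn)
  have hunion : {S | ∃ N, ∀ n ≥ N, expectedLoss (surrogateLoss γ) D (g n)
      + M * √(Real.log (2 / δ) / (2 * m)) < empiricalLoss (surrogateLoss γ) S (g n)}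
      = ⋃ N, A N := by
    ext S; simp [hA]
  rw [hunion, hmono.measure_iUnion]
  refine iSup_le fun N => ?_
  refine (measure_mono fun S hS => ?_).trans (measure_normalised_sum_gt_le hm D
    (measurable_surrogateLoss_comp γ (hg N)) hM0
    (fun z => surrogateLoss_mem_Icc hγ (hB _ z.2.2).1 (hB _ z.2.2).2 (hM _ z.2.2)) hδ hδ2)
  exact hS N le_rfl

/-- The generalisation bound over real numbers, with the Rademacher complexity finite. -/
theorem measure_exists_minimiser_gt_le (hB : ∀ b ∈ B, 0 ≤ b.2 ∧ b.2 ≤ b.1) {M : ℝ}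
    (hM0 : 0 < M) (hM : ∀ b ∈ B, b.1 ≤ M) (D : Measure (X × B)) [IsProbabilityMeasure D]
    {H : Set (X → ℝ)} (hHmeas : ∀ h ∈ H, Measurable h) (hH : Convex ℝ H)
    (h0 : (0 : X → ℝ) ∈ H) {d : ℕ} (hd : pseudoDim H ≤ d) (hm : 1 ≤ m) (hdm : d ≤ m)
    {γ : ℝ} (hγ : 0 < γ) {δ : ℝ} (hδ : 0 < δ) (hδ2 : δ ≤ 2)
    (hfin : rademacher H D.fst m ≠ ⊤) :
    (Measure.pi fun _ : Fin m => D)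
      {S | ∃ h, IsEmpiricalMinimiser (surrogateLoss γ) S H h ∧
        bestLoss D H + 2 * (rademacher H D.fst m).toReal
          + (γ * M + 2 * M * √(2 * d * Real.log (Real.exp 1 * m / d) / m)
            + 2 * M * √(Real.log (2 / δ) / (2 * m))) < expectedLoss loss D h}
      ≤ ENNReal.ofReal δ := by
  have habs : ∀ (g : X → ℝ) (z : X × B), |loss (g z.1) z.2| ≤ M := fun g z => by
    have := loss_mem_Icc (r := g z.1) (hB _ z.2.2).1 (hB _ z.2.2).2 (hM _ z.2.2)
    exact abs_le.2 ⟨this.1, this.2.trans hM0.le⟩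
  have habs' : ∀ (g : X → ℝ) (z : X × B), |surrogateLoss γ (g z.1) z.2| ≤ M := fun g z => by
    have := surrogateLoss_mem_Icc (r := g z.1) hγ (hB _ z.2.2).1 (hB _ z.2.2).2 (hM _ z.2.2)
    exact abs_le.2 ⟨this.1, this.2.trans hM0.le⟩
  have hle : ∀ g ∈ H, expectedLoss (surrogateLoss γ) D g ≤ expectedLoss loss D g := fun g hg =>
    integral_mono
      (integrable_of_measurable_of_abs_le (measurable_surrogateLoss_comp γ (hHmeas g hg)) (habs' g))
      (integrable_of_measurable_of_abs_le (measurable_loss_comp (hHmeas g hg)) (habs g))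
      fun z => surrogateLoss_le_loss hγ (hB _ z.2.2).2
  have hne : (expectedLoss loss D '' H).Nonempty := ⟨_, 0, h0, rfl⟩
  have hex : ∀ n : ℕ, ∃ g ∈ H, expectedLoss loss D g < bestLoss D H + 1 / ((n : ℝ) + 1) :=
    fun n => by
    obtain ⟨_, ⟨g, hg, rfl⟩, hlt⟩ := exists_lt_of_csInf_lt hne
      (lt_add_of_pos_right (bestLoss D H) (by positivity : (0 : ℝ) < 1 / ((n : ℝ) + 1)))
    exact ⟨g, hg, hlt⟩
  choose g hgH hg using hex
  have e1 := measure_exists_loss_deviation_gt_le hB hM0 hM D hHmeas hH h0 hd hm hdm hδ hδ2 hfin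
  have e2 := measure_eventually_surrogateLoss_gt_le hB hM0 hM D hγ hm hδ hδ2
    (fun n => hHmeas _ (hgH n))
  have hδδ : ENNReal.ofReal δ = ENNReal.ofReal (δ / 2) + ENNReal.ofReal (δ / 2) := by
    rw [← ENNReal.ofReal_add (by positivity) (by positivity), add_halves]
  rw [hδδ]
  refine le_trans (measure_mono fun S hS => ?_) ((measure_union_le _ _).trans (add_le_add e1 e2))
  obtain ⟨h, hmin, hgt⟩ := hS
  by_cases hdev : ∃ h ∈ H, 2 * ((rademacher H D.fst m).toReal
          + M * √(2 * d * Real.log (Real.exp 1 * m / d) / m))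
          + M * √(Real.log (2 / δ) / (2 * m))
        < expectedLoss loss D h - empiricalLoss loss S h
  · exact Or.inl hdev
  right
  push Not at hdev
  have h1 := hdev h hmin.1
  have h2 := empiricalLoss_le_of_isEmpiricalMinimiser hB hM hH h0 hγ hm hmin
  -- The violation is strict, so its slack absorbs the error 1/(n+1) for all n ≥ N.
  obtain ⟨N, hN⟩ := exists_nat_one_div_lt (sub_pos.2 hgt)
  refine ⟨N, fun n hn => ?_⟩
  have h3 := hmin.2 _ (hgH n)
  have h4 := hle _ (hgH n)
  have h5 := hg n
  have h6 : 1 / ((n : ℝ) + 1) ≤ 1 / ((N : ℝ) + 1) := Nat.one_div_le_one_div hn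
  linarith

end Generalisation

end ReserveLearning

/-! ### Degenerate cases and the final bound. -/

theorem mainTheorem3 {X : Type*} [MeasurableSpace X]
    (B : Set (ℝ × ℝ)) (hB : ∀ b ∈ B, 0 ≤ b.2 ∧ b.2 ≤ b.1)
    (hBbdd : BddAbove (Prod.fst '' B)) (M : ℝ) (hM : M = sSup (Prod.fst '' B))
    (D : Measure (X × B)) [IsProbabilityMeasure D]
    (H : Set (X → ℝ)) (hHmeas : ∀ h ∈ H, Measurable h)
    (hHconv : Convex ℝ H) (hH0 : (0 : X → ℝ) ∈ H)
    (d : ℕ) (hd : pseudoDim H = d) (m : ℕ) (hm : 1 ≤ m) (hdm : d ≤ m)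
    (γ : ℝ) (hγ : 0 < γ) (δ : ℝ) (hδ : 0 < δ) :
    (Measure.pi fun _ : Fin m => D)
      {S : Fin m → X × B | ¬ ∀ h : X → ℝ, IsEmpiricalMinimiser (surrogateLoss γ) S H h →
        (expectedLoss loss D h : EReal) ≤
          (bestLoss D H : EReal)
          + (((2 * γ + 2) / γ : ℝ) : EReal) * (rademacher H D.fst m : EReal)
          + ((γ * M
              + 2 * M * √(2 * d * Real.log (Real.exp 1 * m / d) / m)
              + 2 * M * √(Real.log (2 / δ) / (2 * m)) : ℝ) : EReal)}
      ≤ ENNReal.ofReal δ := by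
  have hbM : ∀ b ∈ B, b.1 ≤ M := fun b hb => hM ▸ le_csSup hBbdd ⟨b, hb, rfl⟩
  have hcoef : (0 : ℝ) < (2 * γ + 2) / γ := by positivity
  -- For δ ≥ 2 a probability is trivially at most δ; otherwise log(2/δ) ≥ 0.
  rcases le_total 2 δ with hδ2 | hδ2
  · exact prob_le_one.trans (by rw [ENNReal.one_le_ofReal]; linarith)
  by_cases hfin : rademacher H D.fst m = ⊤
  · refine (measure_mono (t := ∅) fun S hS => ?_).trans (by simp)
    rw [Set.mem_ofPred_eq] at hS
    refine (hS fun h _ => ?_).elim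
    rw [hfin, EReal.coe_ennreal_top, EReal.coe_mul_top_of_pos hcoef, EReal.coe_add_top,
      EReal.top_add_coe]
    exact le_top
  set R := (rademacher H D.fst m).toReal with hR
  have hR0 : 0 ≤ R := ENNReal.toReal_nonneg
  have hRcoe : (rademacher H D.fst m : EReal) = (R : EReal) :=
    (EReal.coe_ennreal_toReal hfin).symm
  have hRle : 2 * R ≤ (2 * γ + 2) / γ * R := by
    refine mul_le_mul_of_nonneg_right ?_ hR0
    rw [le_div_iff₀ hγ]; linarith
  rw [hRcoe]
  simp only [← EReal.coe_mul, ← EReal.coe_add, EReal.coe_le_coe_iff]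
  obtain ⟨z⟩ : Nonempty (X × B) := nonempty_of_isProbabilityMeasure D
  have hz := hB _ z.2.2
  have hMnonneg : 0 ≤ M := (hz.1.trans hz.2).trans (hbM _ z.2.2)
  -- If M = 0 all bids and losses vanish; the concentration bounds need the oscillation M/m to be
  -- positive.
  rcases hMnonneg.eq_or_lt with hM0 | hM0
  · have hloss : ∀ h : X → ℝ, expectedLoss loss D h = 0 := fun h => by
      unfold expectedLoss
      rw [← integral_zero (X × B) ℝ (μ := D)]
      congr 1; ext z
      have := loss_mem_Icc (r := h z.1) (hB _ z.2.2).1 (hB _ z.2.2).2 (hbM _ z.2.2)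
      rw [← hM0, neg_zero] at this
      exact le_antisymm this.2 this.1
    have hbest : bestLoss D H = 0 := by
      unfold bestLoss
      have : expectedLoss loss D '' H = {0} := by
        ext y
        constructor
        · rintro ⟨h, -, rfl⟩; exact hloss h
        · rintro rfl; exact ⟨0, hH0, hloss 0⟩
      rw [this, csInf_singleton]
    refine (measure_mono (t := ∅) fun S hS => ?_).trans (by simp)
    rw [Set.mem_ofPred_eq] at hS
    refine (hS fun h _ => ?_).elim
    rw [hloss, hbest, ← hM0]
    have : 0 ≤ (2 * γ + 2) / γ * R := by positivity
    simpa using this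
  · refine (measure_mono fun S hS => ?_).trans (measure_exists_minimiser_gt_le hB hM0 hbM D hHmeas
      hHconv hH0 hd.le hm hdm hγ hδ hδ2 hfin)
    simp only [Set.mem_ofPred_eq, not_forall, not_le] at hS ⊢
    obtain ⟨h, hmin, hlt⟩ := hS
    exact ⟨h, hmin, by linarith⟩
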